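/- Let $\mathcal N:[0,\infty)\to\mathbb R$ be a \emph{saturable} nonlinearity: $\mathcal N$ is smooth on $[0,\infty)$, $\mathcal N'(s)<0$ for $s>0$, $\mathcal N(0)=1$, $\mathcal N(1)=0$, and there are $\mathcal N_\infty<0$ and $\alpha>0$ such that $\mathcal N(s)\to\mathcal N_\infty$ as $s\to\infty$ and, as $r\to\infty$, $\mathcal N(r^2)-\mathcal N_\infty=O(r^{-\alpha})$ and $\mathcal N^{(k)}(r^2)=O(r^{-\alpha-k})$ for every $k\ge1$. Let $c\in\mathbb R$, $c\neq\pm1$, and let $b_*=(u_*,v_*):\mathbb R\to\mathbb R^2$ be a bounded traveling wave profile of speed $c$, i.e. a bounded solution of $$u_*'=\frac{\mathcal N(u_*^2+v_*^2)}{1-c^2}(u_*+cv_*),\qquad v_*'=\frac{\mathcal N(u_*^2+v_*^2)}{1-c^2}(-cu_*-v_*)$$ on $\mathbb R$ (for instance a pulse, a kink or an antikink). Put $\Sigma=\begin{bmatrix}c&1\\1&c\end{bmatrix}$, let $T_c(t)=\exp(t\Sigma\partial_x)$ be the associated unitary group on $L^2(\mathbb R;\mathbb R^2)$, and for $B=(U,V)$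 let $$N_*(x;B)=\begin{bmatrix}\mathcal N(|b_*(x)|^2)V+\delta\mathcal N_*\,v_*(x)\\-\mathcal N(|b_*(x)|^2)U-\delta\mathcal N_*\,u_*(x)\end{bmatrix},\qquad \delta\mathcal N_*=\mathcal N(|b_*(x)+B|^2)-\mathcal N(|b_*(x)|^2).$$ A mild solution of the perturbation equation $B_t=\Sigma B_x+N_*(x;B)$, $B(0)=B_0$, is a solution of $$B(t)=T_c(t)B_0+\int_0^tT_c(t-t')\,N_*(\cdot;B(t'))\,dt',\qquad t\ge0,$$ the integral being taken in $L^2$. (a) There is a constant $C>0$, depending on $\mathcal N$, $c$ and $b_*$ but not on $B_0$, such that for every $B_0\in H^1(\mathbb R;\mathbb R^2)$ the perturbation equation has a global mild solution $$B\in C^0\big([0,\infty),H^1\big)\cap C^1\big([0,\infty),L^2\big),$$ it is the only mild solution in this class (indeed the only one in $C^0([0,\infty),H^1)$), and $$\|B(t)\|_{H^1}\le Ce^{Ct}\|B_0\|_{H^1}\qquad\text{for all }t\ge0.$$ (b) If moreover $\mathcal N'(s)=O(1/s)$ as $s\to\infty$, the same assertion holds with $N_*(x;B)$ replaced by $$\begin{bmatrix}\mathcal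 N(|b_*(x)+B|^2)V+\delta\mathcal N_*\,v_*(x)\\-\mathcal N(|b_*(x)+B|^2)U-\delta\mathcal N_*\,u_*(x)\end{bmatrix},$$ which is the term obtained by substituting $b=b_*+B$ exactly in $u_t=cu_x+v_x+\mathcal N(u^2+v^2)v$, $v_t=u_x+cv_x-\mathcal N(u^2+v^2)u$. -/

import Mathlib

open MeasureTheory Set Filter Topology Asymptotics
open scoped ContDiff Matrix

namespace DimerWave

noncomputable section

/-! ### Function spaces -/

/-- The plane `ℝ²` with its Euclidean norm; a vector is `(u, v) = (w 0, w 1)`. -/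
abbrev Plane : Type := EuclideanSpace ℝ (Fin 2)

/-- `L²(ℝ; ℝ²)`. -/
abbrev L2 : Type := Lp Plane 2 (volume : Measure ℝ)

/-- `g` is the weak (distributional) derivative of `f` on the real line. -/
def IsWeakDeriv (f g : ℝ → Plane) : Prop :=
  ∀ φ : ℝ → ℝ, ContDiff ℝ ∞ φ → HasCompactSupport φ →
    ∫ x, deriv φ x • f x = - ∫ x, φ x • g x

theorem integrable_smul_of_L2 {φ : ℝ → ℝ} (hφ : Continuous φ) (hc : HasCompactSupport φ)
    (f : L2) : Integrable (fun x => φ x • f x) volume := by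
  have h := (Lp.memLp f).smul (r := 1) (hφ.memLp_of_hasCompactSupport (p := 2) (μ := volume) hc)
  exact memLp_one_iff_integrable.mp h

theorem integral_smul_add {φ : ℝ → ℝ} (hφ : Continuous φ) (hc : HasCompactSupport φ)
    (f g : L2) :
    ∫ x, φ x • (f + g : L2) x = (∫ x, φ x • f x) + ∫ x, φ x • g x := by
  rw [← integral_add (integrable_smul_of_L2 hφ hc f) (integrable_smul_of_L2 hφ hc g)]
  refine integral_congr_ae ?_
  filter_upwards [Lp.coeFn_add f g] with x hx
  rw [hx, Pi.add_apply, smul_add]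

theorem integral_smul_smul (φ : ℝ → ℝ) (a : ℝ) (f : L2) :
    ∫ x, φ x • (a • f : L2) x = a • ∫ x, φ x • f x := by
  rw [← integral_smul]
  refine integral_congr_ae ?_
  filter_upwards [Lp.coeFn_smul a f] with x hx
  simp only [hx, Pi.smul_apply]
  rw [smul_comm]

/-- `H¹(ℝ; ℝ²)`, realised as the space of pairs `(f, f')` of `L²` functions in which the second is
the weak derivative of the first. Its norm is `(‖f‖² + ‖f'‖²)^{1/2}` with `L²` norms. -/
def H1 : Submodule ℝ (WithLp 2 (L2 × L2)) where
  carrier := {p | IsWeakDeriv p.fst p.snd}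
  zero_mem' := by
    intro φ _ _
    have h0 : ∀ ψ : ℝ → ℝ, ∫ x, ψ x • (0 : L2) x = 0 := by
      intro ψ
      have h := integral_smul_smul ψ 0 0
      rwa [zero_smul, zero_smul] at h
    simp only [WithLp.zero_fst, WithLp.zero_snd, h0, neg_zero]
  add_mem' := by
    intro p q hp hq φ h1 h2
    have hd : Continuous (deriv φ) := h1.continuous_deriv (by simp)
    simp only [WithLp.add_fst, WithLp.add_snd]
    rw [integral_smul_add hd h2.deriv, integral_smul_add h1.continuous h2, hp φ h1 h2, hq φ h1 h2]
    abel
  smul_mem' := by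
    intro a p hp φ h1 h2
    simp only [WithLp.smul_fst, WithLp.smul_snd]
    rw [integral_smul_smul, integral_smul_smul, hp φ h1 h2, smul_neg]

/-- The inclusion of `H¹` in `L²`. -/
def toL2 (B : H1) : L2 := (B : WithLp 2 (L2 × L2)).fst

theorem H1_norm_sq (B : H1) :
    ‖B‖ ^ 2 = ‖toL2 B‖ ^ 2 + ‖(B : WithLp 2 (L2 × L2)).snd‖ ^ 2 := by
  rw [toL2, ← WithLp.prod_norm_sq_eq_of_L2]
  rfl

/-! ### The nonlinearity and the traveling waves -/

/-- A saturable nonlinearity `N(s)`, `0 ≤ s < ∞`. -/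
structure IsSaturable (N : ℝ → ℝ) : Prop where
  smooth : ContDiffOn ℝ ∞ N (Ici 0)
  deriv_neg : ∀ s, 0 < s → deriv N s < 0
  at_zero : N 0 = 1
  at_one : N 1 = 0
  saturates : ∃ Ninf : ℝ, Ninf < 0 ∧ Tendsto N atTop (𝓝 Ninf) ∧
    ∃ α : ℝ, 0 < α ∧
      ((fun r : ℝ => N (r ^ 2) - Ninf) =O[atTop] fun r : ℝ => r ^ (-α)) ∧
      ∀ k : ℕ, 1 ≤ k →
        (fun r : ℝ => iteratedDeriv k N (r ^ 2)) =O[atTop] fun r : ℝ => r ^ (-α - (k : ℝ))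

/-- `b = (u, v)` is the profile of a bounded traveling wave of speed `c`: a bounded orbit of
`u' = N(u² + v²) (u + c v) / (1 - c²)`, `v' = N(u² + v²) (- c u - v) / (1 - c²)`. -/
structure IsTravelingWaveProfile (N : ℝ → ℝ) (c : ℝ) (b : ℝ → Plane) : Prop where
  eq_u : ∀ x, HasDerivAt (fun y => b y 0)
    (N ((b x 0) ^ 2 + (b x 1) ^ 2) / (1 - c ^ 2) * (b x 0 + c * b x 1)) x
  eq_v : ∀ x, HasDerivAt (fun y => b y 1)
    (N ((b x 0) ^ 2 + (b x 1) ^ 2) / (1 - c ^ 2) * (-c * b x 0 - b x 1)) x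
  bounded : ∃ M : ℝ, ∀ x, ‖b x‖ ≤ M

/-- `δN(x; U, V) = N((u + U)² + (v + V)²) - N(u² + v²)` with `(u, v) = b(x)`. -/
def deltaN (N : ℝ → ℝ) (b : ℝ → Plane) (x : ℝ) (W : Plane) : ℝ :=
  N ((b x 0 + W 0) ^ 2 + (b x 1 + W 1) ^ 2) - N ((b x 0) ^ 2 + (b x 1) ^ 2)

/-- The zeroth order term
`(N(|b|²) V + δN(x; U, V) v, - N(|b|²) U - δN(x; U, V) u)`, `(u, v) = b(x)`. -/
def pertNonlinearity (N : ℝ → ℝ) (b : ℝ → Plane) (x : ℝ) (W : Plane) : Plane :=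
  !₂[N ((b x 0) ^ 2 + (b x 1) ^ 2) * W 1 + deltaN N b x W * b x 1,
    -(N ((b x 0) ^ 2 + (b x 1) ^ 2) * W 0) - deltaN N b x W * b x 0]

/-- The zeroth order term
`(N(|b + B|²) V + δN(x; U, V) v, - N(|b + B|²) U - δN(x; U, V) u)`, `B = (U, V)`,
`(u, v) = b(x)`, of the equation for the difference `B` of a solution and the wave `b`. -/
def exactPertNonlinearity (N : ℝ → ℝ) (b : ℝ → Plane) (x : ℝ) (W : Plane) : Plane :=
  !₂[N ((b x 0 + W 0) ^ 2 + (b x 1 + W 1) ^ 2) * W 1 + deltaN N b x W * b x 1,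
    -(N ((b x 0 + W 0) ^ 2 + (b x 1 + W 1) ^ 2) * W 0) - deltaN N b x W * b x 0]

/-! ### The group `exp (t Σ ∂ₓ)`, `Σ = [[c, 1], [1, c]]` -/

/-- The spectral projection of `Σ` for the eigenvalue `c + 1`. -/
def projPlus : Plane →L[ℝ] Plane :=
  Matrix.toEuclideanCLM (n := Fin 2) (𝕜 := ℝ) !![1 / 2, 1 / 2; 1 / 2, 1 / 2]

/-- The spectral projection of `Σ` for the eigenvalue `c - 1`. -/
def projMinus : Plane →L[ℝ] Plane :=
  Matrix.toEuclideanCLM (n := Fin 2) (𝕜 := ℝ) !![1 / 2, -1 / 2; -1 / 2, 1 / 2]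

/-- `exp (t Σ ∂ₓ) f` for a function `f`: since `Σ = (c + 1) P₊ + (c - 1) P₋` and
`exp (a ∂ₓ)` is the translation by `a`, it is `P₊ f(x + (c + 1) t) + P₋ f(x + (c - 1) t)`. -/
def freeEvolution (c t : ℝ) (f : ℝ → Plane) (x : ℝ) : Plane :=
  projPlus (f (x + (c + 1) * t)) + projMinus (f (x + (c - 1) * t))

/-- The translation `f ↦ f(· + a)` on `L²`. -/
def translate (a : ℝ) : L2 →L[ℝ] L2 :=
  (Lp.compMeasurePreservingₗᵢ ℝ (fun x : ℝ => x + a)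
    (measurePreserving_add_right volume a)).toContinuousLinearMap

/-- The group `T_c(t) = exp (t Σ ∂ₓ)` on `L²`. -/
def freeGroup (c t : ℝ) : L2 →L[ℝ] L2 :=
  (projPlus.compLpL 2 volume).comp (translate ((c + 1) * t)) +
    (projMinus.compLpL 2 volume).comp (translate ((c - 1) * t))

theorem translate_coeFn (a : ℝ) (f : L2) : translate a f =ᵐ[volume] fun x => f (x + a) :=
  Lp.coeFn_compMeasurePreserving f (measurePreserving_add_right volume a)

theorem freeGroup_coeFn (c t : ℝ) (f : L2) :
    freeGroup c t f =ᵐ[volume] freeEvolution c t f := by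
  have e : freeGroup c t f = projPlus.compLp (translate ((c + 1) * t) f) +
      projMinus.compLp (translate ((c - 1) * t) f) := rfl
  rw [e]
  filter_upwards [Lp.coeFn_add (projPlus.compLp (translate ((c + 1) * t) f))
      (projMinus.compLp (translate ((c - 1) * t) f)),
    projPlus.coeFn_compLp (translate ((c + 1) * t) f),
    projMinus.coeFn_compLp (translate ((c - 1) * t) f),
    translate_coeFn ((c + 1) * t) f, translate_coeFn ((c - 1) * t) f] with x h1 h2 h3 h4 h5
  rw [h1, Pi.add_apply, h2, h3, h4, h5, freeEvolution]

/-- The Fourier transform `k ↦ ∫ e^{-ikx} f(x) dx`, taken in each component. -/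
def fourierVec (f : ℝ → Plane) (k : ℝ) : Fin 2 → ℂ :=
  fun i => ∫ x : ℝ, Complex.exp (-(Complex.I * k * x)) * ((f x i : ℝ) : ℂ)

theorem fourierVec_translate (f : ℝ → Plane) (a k : ℝ) (i : Fin 2) :
    fourierVec (fun x => f (x + a)) k i = Complex.exp (Complex.I * k * a) * fourierVec f k i := by
  simp only [fourierVec]
  rw [← integral_const_mul, ← integral_add_right_eq_self (fun y : ℝ =>
    Complex.exp (Complex.I * k * a) * (Complex.exp (-(Complex.I * k * y)) * ((f y i : ℝ) : ℂ))) a]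
  refine integral_congr_ae (Eventually.of_forall fun x => ?_)
  simp only
  rw [← mul_assoc, ← Complex.exp_add]
  congr 2
  push_cast
  ring

theorem integrable_fourierVec {f : ℝ → Plane} (hf : Integrable f) (a k : ℝ) (i : Fin 2) :
    Integrable fun x : ℝ =>
      Complex.exp (-(Complex.I * k * x)) * ((f (x + a) i : ℝ) : ℂ) := by
  have h1 : Integrable fun x : ℝ => ((f (x + a) i : ℝ) : ℂ) :=
    (((EuclideanSpace.proj (𝕜 := ℝ) i).integrable_comp hf).comp_add_right a).ofReal
  refine h1.bdd_mul (c := 1) (by fun_prop) (Eventually.of_forall fun x => ?_)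
  simp [Complex.norm_exp]

theorem exp_symbol (c : ℝ) (z : ℂ) :
    NormedSpace.exp (z • !![(c : ℂ), 1; 1, (c : ℂ)]) =
      !![(Complex.exp (z * (c + 1)) + Complex.exp (z * (c - 1))) / 2,
          (Complex.exp (z * (c + 1)) - Complex.exp (z * (c - 1))) / 2;
        (Complex.exp (z * (c + 1)) - Complex.exp (z * (c - 1))) / 2,
          (Complex.exp (z * (c + 1)) + Complex.exp (z * (c - 1))) / 2] := by
  have hdet : IsUnit (!![(1 : ℂ), 1; 1, -1]).det := by
    rw [Matrix.det_fin_two_of]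
    norm_num
  have hU : IsUnit !![(1 : ℂ), 1; 1, -1] := (Matrix.isUnit_iff_isUnit_det _).mpr hdet
  have hinv : (!![(1 : ℂ), 1; 1, -1])⁻¹ = !![(1 / 2 : ℂ), 1 / 2; 1 / 2, -1 / 2] := by
    refine Matrix.inv_eq_right_inv ?_
    ext i j
    fin_cases i <;> fin_cases j <;> norm_num [Matrix.mul_apply, Fin.sum_univ_two]
  have hd : ∀ p q : ℂ, Matrix.diagonal ![p, q] = !![p, 0; 0, q] := by
    intro p q
    ext i j
    fin_cases i <;> fin_cases j <;> simp
  have hx : NormedSpace.exp ![z * (c + 1), z * (c - 1)] =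
      ![Complex.exp (z * (c + 1)), Complex.exp (z * (c - 1))] := by
    ext i
    rw [Pi.coe_exp]
    fin_cases i <;> simp [Complex.exp_eq_exp_ℂ]
  have e : z • !![(c : ℂ), 1; 1, (c : ℂ)] = !![(1 : ℂ), 1; 1, -1] *
      Matrix.diagonal ![z * (c + 1), z * (c - 1)] * (!![(1 : ℂ), 1; 1, -1])⁻¹ := by
    rw [hinv, hd]
    ext i j
    fin_cases i <;> fin_cases j <;> simp [Matrix.mul_apply, Fin.sum_univ_two] <;> ring
  rw [e, Matrix.exp_conj _ _ hU, Matrix.exp_diagonal, hinv, hx, hd]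
  ext i j
  fin_cases i <;> fin_cases j <;> simp [Matrix.mul_apply, Fin.sum_univ_two] <;> ring

/-- On the Fourier side `T_c(t)` is multiplication by the matrix exponential `exp (i k t Σ)`. -/
theorem fourierVec_freeEvolution (c t k : ℝ) {f : ℝ → Plane} (hf : Integrable f) :
    fourierVec (freeEvolution c t f) k =
      NormedSpace.exp ((Complex.I * k * t) • !![(c : ℂ), 1; 1, (c : ℂ)]) *ᵥ fourierVec f k := by
  have hs : ∀ (a b : ℝ) (ε : ℂ),
      (∫ x : ℝ, ((Complex.exp (-(Complex.I * k * x)) * ((f (x + a) 0 : ℝ) : ℂ) +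
        Complex.exp (-(Complex.I * k * x)) * ((f (x + a) 1 : ℝ) : ℂ)) / 2 +
        ε * (Complex.exp (-(Complex.I * k * x)) * ((f (x + b) 0 : ℝ) : ℂ) -
        Complex.exp (-(Complex.I * k * x)) * ((f (x + b) 1 : ℝ) : ℂ)) / 2)) =
      (Complex.exp (Complex.I * k * a) * fourierVec f k 0 +
        Complex.exp (Complex.I * k * a) * fourierVec f k 1) / 2 +
      ε * (Complex.exp (Complex.I * k * b) * fourierVec f k 0 -
        Complex.exp (Complex.I * k * b) * fourierVec f k 1) / 2 := by
    intro a b ε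
    have I := fun (a : ℝ) (i : Fin 2) => integrable_fourierVec hf a k i
    have J1 := ((I a 0).add (I a 1)).div_const 2
    have J2 := (((I b 0).sub (I b 1)).const_mul ε).div_const 2
    refine (integral_add J1 J2).trans ?_
    rw [integral_div, integral_div, integral_const_mul]
    simp only [Pi.add_apply, Pi.sub_apply]
    rw [integral_add (I a 0) (I a 1), integral_sub (I b 0) (I b 1)]
    simp only [← fourierVec_translate]
    rfl
  rw [exp_symbol]
  ext i
  fin_cases i
  · have h := hs ((c + 1) * t) ((c - 1) * t) 1
    simp only [fourierVec, freeEvolution, projPlus, projMinus, Matrix.mulVec, dotProduct,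
      Fin.sum_univ_two] at h ⊢
    refine (integral_congr_ae (Eventually.of_forall fun x => ?_)).trans (h.trans ?_)
    · simp [Matrix.mulVec, dotProduct, Fin.sum_univ_two]
      ring
    · simp
      ring_nf
  · have h := hs ((c + 1) * t) ((c - 1) * t) (-1)
    simp only [fourierVec, freeEvolution, projPlus, projMinus, Matrix.mulVec, dotProduct,
      Fin.sum_univ_two] at h ⊢
    refine (integral_congr_ae (Eventually.of_forall fun x => ?_)).trans (h.trans ?_)
    · simp [Matrix.mulVec, dotProduct, Fin.sum_univ_two]
      ring
    · simp
      ring_nf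

/-! ### Mild solutions -/

/-- `B` is a mild solution on `[0, ∞)` of `B_t = Σ B_x + f(x, B)`, `B(0) = B₀`, that is
`B(t) = T_c(t) B₀ + ∫_0^t T_c(t - s) f(·, B(s)) ds`, the integral being a Bochner integral in `L²`.
Here `F s` is the element `f(·, B(s))` of `L²`. -/
def IsMildSolution (c : ℝ) (f : ℝ → Plane → Plane) (B₀ : L2) (B : ℝ → L2) : Prop :=
  ∃ F : ℝ → L2,
    (∀ s, 0 ≤ s → F s =ᵐ[volume] fun x => f x (B s x)) ∧
    ∀ t, 0 ≤ t →
      IntervalIntegrable (fun s => freeGroup c (t - s) (F s)) volume 0 t ∧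
      B t = freeGroup c t B₀ + ∫ s in (0 : ℝ)..t, freeGroup c (t - s) (F s)

/-- Global well-posedness in `H¹` of the mild initial value problem for `B_t = Σ B_x + f(x, B)`,
with the bound `‖B(t)‖_{H¹} ≤ C e^{C t} ‖B₀‖_{H¹}`, where `C` does not depend on `B₀`.
Uniqueness is claimed among all mild solutions that are continuous with values in `H¹`. -/
def IsGloballyWellPosed (c : ℝ) (f : ℝ → Plane → Plane) : Prop :=
  ∃ C : ℝ, 0 < C ∧ ∀ B₀ : H1, ∃ B : ℝ → H1,
    ContinuousOn B (Ici 0) ∧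
    ContDiffOn ℝ 1 (fun t => toL2 (B t)) (Ici 0) ∧
    IsMildSolution c f (toL2 B₀) (fun t => toL2 (B t)) ∧
    (∀ t, 0 ≤ t → ‖B t‖ ≤ C * Real.exp (C * t) * ‖B₀‖) ∧
    ∀ B' : ℝ → H1, ContinuousOn B' (Ici 0) →
      IsMildSolution c f (toL2 B₀) (fun t => toL2 (B' t)) → EqOn B' B (Ici 0)

end

end DimerWave

namespace DimerWave

noncomputable section

/-! ### Absolutely continuous functions on the line -/

/-! In the moving frame `w(t) = T_c(-t) B(t)` the unbounded operator `Σ ∂ₓ` disappears: a mild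
solution becomes a solution of the ODE `w' = T_c(-t) f(·, T_c(t) w)`, and the group is bounded on
`L²` and on `H¹` uniformly in time. Everything then rests on the superposition operator `u ↦ f(·,
u)`.

`IsRegularTerm` isolates what is needed of `f`. The chain rule (`isWeakDeriv_superposition`) makes
the operator act on `H¹`. It is globally Lipschitz on `L²`, of linear growth on `H¹`
(`norm_superpositionH1_le`), and Lipschitz on bounded sets of `H¹` by the Sobolev embedding
(`exists_lipschitz_superpositionH1`). Linear growth with Gronwall makes the `H¹` solution global
with an exponential bound whose constant ignores the data (`exists_global_solution`). Uniqueness is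
proved in `L²`, where the field is globally Lipschitz. The `C¹` regularity in `L²` comes from
differentiating `T_c(t) w(t)` along each characteristic, `w(t)` having a weak derivative.

It remains to see that both terms are regular (`isRegularTerm_of_profile`). In (a) the factor `N(|b
+ W|²)` multiplies only the bounded `b`, so it suffices that `y ↦ N(|y|²)` is bounded and globally
Lipschitz, which saturation gives. In (b) the term is the increment from `b` to `b + W` of `y ↦
N(|y|²) rot y`; this map is globally Lipschitz once `|y|² N'(|y|²)` is bounded at infinity, which is
the condition `N'(s) = O(1/s)`. -/

theorem absolutelyContinuousOnInterval_of_dist_le {X Y : Type*} [PseudoMetricSpace X]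
    [PseudoMetricSpace Y] {h : ℝ → X} {G : ℝ → Y} {a b C : ℝ}
    (hG : AbsolutelyContinuousOnInterval G a b)
    (hh : ∀ x ∈ uIcc a b, ∀ y ∈ uIcc a b, dist (h x) (h y) ≤ C * dist (G x) (G y)) :
    AbsolutelyContinuousOnInterval h a b := by
  have h1 : Tendsto (fun E : ℕ × (ℕ → ℝ × ℝ) =>
      C * ∑ i ∈ Finset.range E.1, dist (G (E.2 i).1) (G (E.2 i).2))
      (AbsolutelyContinuousOnInterval.totalLengthFilter ⊓
        𝓟 (AbsolutelyContinuousOnInterval.disjWithin a b)) (𝓝 0) := by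
    simpa using Tendsto.const_mul C hG
  refine squeeze_zero' (Eventually.of_forall fun E => Finset.sum_nonneg fun _ _ => dist_nonneg)
    ?_ h1
  -- The filter only sees families of subintervals of `[a, b]`, so the bound on increments is needed
  -- only there.
  have h2 : ∀ᶠ E in AbsolutelyContinuousOnInterval.totalLengthFilter ⊓
      𝓟 (AbsolutelyContinuousOnInterval.disjWithin a b),
      E ∈ AbsolutelyContinuousOnInterval.disjWithin a b :=
    eventually_inf_principal.mpr (by simp)
  filter_upwards [h2] with E hE
  rw [Finset.mul_sum]
  exact Finset.sum_le_sum fun i hi => hh _ (hE.1 i hi).1 _ (hE.1 i hi).2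

section Vector

theorem intervalIntegrable_of_locallyIntegrable {F : Type*} [NormedAddCommGroup F]
    {g : ℝ → F} (hg : LocallyIntegrable g) (x y : ℝ) : IntervalIntegrable g volume x y :=
  intervalIntegrable_iff.mpr
    ((hg.integrableOn_isCompact isCompact_uIcc).mono_set uIoc_subset_uIcc)

variable {F : Type*} [NormedAddCommGroup F] [NormedSpace ℝ F]

theorem dist_intervalIntegral_le {g : ℝ → F} (hg : LocallyIntegrable g) (c x y : ℝ) :
    dist (∫ t in c..x, g t) (∫ t in c..y, g t) ≤
      dist (∫ t in c..x, ‖g t‖) (∫ t in c..y, ‖g t‖) := by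
  have I : ∀ x y : ℝ, IntervalIntegrable g volume x y :=
    intervalIntegrable_of_locallyIntegrable hg
  rw [dist_eq_norm, dist_eq_norm, intervalIntegral.integral_interval_sub_left (I _ _) (I _ _),
    intervalIntegral.integral_interval_sub_left (I _ _).norm (I _ _).norm, Real.norm_eq_abs]
  exact intervalIntegral.norm_integral_le_abs_integral_norm

/-- Increments of the vector primitive are dominated by those of the real primitive of `‖g‖`, which
is absolutely continuous. -/
theorem absolutelyContinuousOnInterval_integral {g : ℝ → F} (hg : LocallyIntegrable g)
    (c a b : ℝ) : AbsolutelyContinuousOnInterval (fun x => ∫ t in c..x, g t) a b := by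
  have hn : AbsolutelyContinuousOnInterval (fun x => ∫ t in a..x, ‖g t‖) a b :=
    IntervalIntegrable.absolutelyContinuousOnInterval_intervalIntegral
      (intervalIntegrable_of_locallyIntegrable hg a b).norm (by simp)
  refine absolutelyContinuousOnInterval_of_dist_le (C := 1) hn fun x _ y _ => ?_
  rw [one_mul]
  refine le_trans (le_of_eq ?_) (dist_intervalIntegral_le hg a x y)
  have I : ∀ x y : ℝ, IntervalIntegrable g volume x y :=
    intervalIntegrable_of_locallyIntegrable hg
  rw [dist_eq_norm, dist_eq_norm, intervalIntegral.integral_interval_sub_left (I _ _) (I _ _),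
    intervalIntegral.integral_interval_sub_left (I _ _) (I _ _)]

/-- Subtracting the primitive of `k` leaves an absolutely continuous function with zero derivative
almost everywhere, hence a constant. -/
theorem integral_eq_sub_of_absolutelyContinuous [CompleteSpace F] {h k : ℝ → F} {a b : ℝ}
    (hh : AbsolutelyContinuousOnInterval h a b) (hk : LocallyIntegrable k)
    (hd : ∀ᵐ x, HasDerivAt h (k x) x) : ∫ x in a..b, k x = h b - h a := by
  obtain ⟨C, hC⟩ := (hh.sub
    (absolutelyContinuousOnInterval_integral hk a a b)).const_of_ae_hasDerivAt_zero (by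
      filter_upwards [hd, LocallyIntegrable.ae_hasDerivAt_integral hk] with x h1 h2 _
      simpa using h1.sub (h2 a))
  have ha := hC a left_mem_uIcc
  have hb := hC b right_mem_uIcc
  simp only [Pi.sub_apply, intervalIntegral.integral_same, sub_zero] at ha hb
  rw [ha, ← hb]
  abel

/-- The fundamental theorem is applied to `φ • h` on an interval `[-R, R]` whose interior contains
the support of `φ`; the boundary terms vanish. -/
theorem integral_deriv_smul_eq_neg_of_absolutelyContinuous [CompleteSpace F] {h k : ℝ → F}
    (hh : ∀ a b, AbsolutelyContinuousOnInterval h a b) (hk : LocallyIntegrable k)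
    (hd : ∀ᵐ x, HasDerivAt h (k x) x) {φ : ℝ → ℝ} (hφ : ContDiff ℝ ∞ φ)
    (hc : HasCompactSupport φ) :
    ∫ x, deriv φ x • h x = - ∫ x, φ x • k x := by
  have hcont : Continuous h := by
    rw [continuous_iff_continuousAt]
    intro x
    exact ((hh (x - 1) (x + 1)).continuousOn).continuousAt
      (by rw [uIcc_of_le (by linarith)]; exact Icc_mem_nhds (by linarith) (by linarith))
  have hφ' : Continuous (deriv φ) := hφ.continuous_deriv (by simp)
  have I1 : Integrable fun x => deriv φ x • h x :=
    (hφ'.smul hcont).integrable_of_hasCompactSupport hc.deriv.smul_right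
  have I2 : Integrable fun x => φ x • k x :=
    hk.integrable_smul_left_of_hasCompactSupport hφ.continuous hc
  obtain ⟨R, hR⟩ := hc.isCompact.isBounded.subset_ball 0
  have hsupp : ∀ x, x ∉ Ioo (-R) R → x ∉ tsupport φ := by
    intro x hx h'
    have := hR h'
    rw [Real.ball_eq_Ioo] at this
    simp only [zero_sub, zero_add] at this
    exact hx this
  have hac : AbsolutelyContinuousOnInterval (φ • h) (-R) R :=
    (hφ.of_le (by simp)).contDiffOn.absolutelyContinuousOnInterval.smul (hh _ _)
  have hftc := integral_eq_sub_of_absolutelyContinuous hac (k := fun x =>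
    φ x • k x + deriv φ x • h x) (I2.add I1).locallyIntegrable (by
      filter_upwards [hd] with x hx
      exact ((hφ.differentiable (by simp)) x).hasDerivAt.smul hx)
  have hz : ∀ x, x ∉ Ioo (-R) R → φ x = 0 := fun x hx => image_eq_zero_of_notMem_tsupport (hsupp x hx)
  have hz' : ∀ x, x ∉ Ioo (-R) R → deriv φ x = 0 := fun x hx =>
    image_eq_zero_of_notMem_tsupport fun h' => hsupp x hx (tsupport_deriv_subset h')
  rw [intervalIntegral.integral_eq_integral_of_support_subset] at hftc
  · rw [integral_add I2 I1] at hftc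
    simp only [Pi.smul_apply', hz R (by simp), hz (-R) (by simp), zero_smul, sub_zero] at hftc
    rw [eq_neg_iff_add_eq_zero, add_comm]
    exact hftc
  · intro x hx
    by_contra h'
    refine hx ?_
    have h'' : x ∉ Ioo (-R) R := fun h => h' (Ioo_subset_Ioc_self h)
    simp [hz x h'', hz' x h'']

/-- To the right of the support the primitive equals the total integral, so mean zero is what makes
it compactly supported. -/
theorem exists_primitive_testFunction {ψ : ℝ → ℝ} (hψ : ContDiff ℝ ∞ ψ)
    (hc : HasCompactSupport ψ) (h0 : ∫ x, ψ x = 0) :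
    ∃ φ : ℝ → ℝ, ContDiff ℝ ∞ φ ∧ HasCompactSupport φ ∧ deriv φ = ψ := by
  obtain ⟨R, hR⟩ := hc.isCompact.isBounded.subset_ball 0
  have hz : ∀ x, x ∉ Ioo (-R) R → ψ x = 0 := by
    intro x hx
    refine image_eq_zero_of_notMem_tsupport fun h' => ?_
    have := hR h'
    rw [Real.ball_eq_Ioo] at this
    simp only [zero_sub, zero_add] at this
    exact hx this
  have hd : ∀ x, HasDerivAt (fun x => ∫ t in (-R)..x, ψ t) (ψ x) x := fun x =>
    intervalIntegral.integral_hasDerivAt_right (hψ.continuous.intervalIntegrable _ _)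
      (hψ.continuous.stronglyMeasurableAtFilter _ _) hψ.continuous.continuousAt
  have hderiv : deriv (fun x => ∫ t in (-R)..x, ψ t) = ψ := funext fun x => (hd x).deriv
  refine ⟨fun x => ∫ t in (-R)..x, ψ t, ?_, ?_, hderiv⟩
  · rw [contDiff_infty_iff_deriv, hderiv]
    exact ⟨fun x => (hd x).differentiableAt, hψ⟩
  · refine HasCompactSupport.intro (isCompact_Icc (a := -R) (b := R)) fun x hx => ?_
    rw [mem_Icc, not_and_or, not_le, not_le] at hx
    rcases hx with hx | hx
    · rw [intervalIntegral.integral_congr (g := fun _ => 0), intervalIntegral.integral_zero]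
      intro t ht
      refine hz t fun h' => ?_
      rw [uIcc_comm, uIcc_of_le hx.le] at ht
      linarith [ht.2, h'.1]
    · rw [intervalIntegral.integral_eq_integral_of_support_subset, h0]
      intro t ht
      by_contra h'
      exact ht (hz t fun h'' => h' ⟨h''.1, by linarith [h''.2]⟩)

/-- Du Bois-Reymond: with a bump `η` of integral one, `ψ - (∫ ψ) η` has mean zero and is the
derivative of a test function, so `∫ ψ w = (∫ ψ) ∫ η w` for every `ψ`. -/
theorem ae_eq_const_of_integral_deriv_smul_eq_zero [CompleteSpace F] {w : ℝ → F}
    (hw : LocallyIntegrable w)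
    (h : ∀ φ : ℝ → ℝ, ContDiff ℝ ∞ φ → HasCompactSupport φ → ∫ x, deriv φ x • w x = 0) :
    ∃ C : F, ∀ᵐ x, w x = C := by
  obtain ⟨η, hη, hηc, hη1⟩ : ∃ η : ℝ → ℝ, ContDiff ℝ ∞ η ∧ HasCompactSupport η ∧
      ∫ x, η x = 1 := by
    let f : ContDiffBump (0 : ℝ) := default
    exact ⟨f.normed volume, f.contDiff_normed, f.hasCompactSupport_normed, f.integral_normed⟩
  refine ⟨∫ x, η x • w x, ae_eq_of_integral_contDiff_smul_eq hw (locallyIntegrable_const _)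
    fun ψ hψ hψc => ?_⟩
  have Iη := hη.continuous.integrable_of_hasCompactSupport (μ := volume) hηc
  have Iψ := hψ.continuous.integrable_of_hasCompactSupport (μ := volume) hψc
  obtain ⟨φ, h1, h2, h3⟩ := exists_primitive_testFunction
    (ψ := fun x => ψ x - (∫ t, ψ t) * η x) (hψ.sub (contDiff_const.mul hη))
    (hψc.sub hηc.mul_left)
    (by rw [integral_sub Iψ (Iη.const_mul _), integral_const_mul, hη1]; ring)
  have h4 := h φ h1 h2
  simp only [h3, sub_smul, mul_smul] at h4
  have h5 : Integrable fun x => (∫ t, ψ t) • η x • w x :=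
    (hw.integrable_smul_left_of_hasCompactSupport hη.continuous hηc).smul (∫ t, ψ t)
  rw [integral_sub (hw.integrable_smul_left_of_hasCompactSupport hψ.continuous hψc) h5,
    integral_smul, sub_eq_zero] at h4
  rw [h4, integral_smul_const]

end Vector

theorem isWeakDeriv_of_absolutelyContinuous {h k : ℝ → Plane}
    (hh : ∀ a b, AbsolutelyContinuousOnInterval h a b) (hk : LocallyIntegrable k)
    (hd : ∀ᵐ x, HasDerivAt h (k x) x) : IsWeakDeriv h k := fun _ hφ hc =>
  integral_deriv_smul_eq_neg_of_absolutelyContinuous hh hk hd hφ hc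

/-- A function with a locally integrable weak derivative has a representative that is a primitive
of it. -/
theorem IsWeakDeriv.exists_primitive {f g : ℝ → Plane} (hf : LocallyIntegrable f)
    (hg : LocallyIntegrable g) (h : IsWeakDeriv f g) :
    ∃ u : ℝ → Plane, f =ᵐ[volume] u ∧ ∀ x y, u y - u x = ∫ t in x..y, g t := by
  have I : ∀ x y : ℝ, IntervalIntegrable g volume x y :=
    intervalIntegrable_of_locallyIntegrable hg
  set G : ℝ → Plane := fun x => ∫ t in (0 : ℝ)..x, g t with hG
  have hGc : Continuous G := intervalIntegral.continuous_primitive I 0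
  have hGw : IsWeakDeriv G g := isWeakDeriv_of_absolutelyContinuous
    (fun a b => absolutelyContinuousOnInterval_integral hg 0 a b) hg
    ((LocallyIntegrable.ae_hasDerivAt_integral hg).mono fun x hx => hx 0)
  obtain ⟨C, hC⟩ := ae_eq_const_of_integral_deriv_smul_eq_zero (w := f - G)
    (hf.sub hGc.locallyIntegrable) (fun φ hφ hc => by
      have hφ' : Continuous (deriv φ) := hφ.continuous_deriv (by simp)
      simp only [Pi.sub_apply, smul_sub]
      rw [integral_sub (hf.integrable_smul_left_of_hasCompactSupport hφ' hc.deriv)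
        (hGc.locallyIntegrable.integrable_smul_left_of_hasCompactSupport hφ' hc.deriv),
        h φ hφ hc, hGw φ hφ hc, sub_self])
  refine ⟨fun x => G x + C, ?_, fun x y => ?_⟩
  · filter_upwards [hC] with x hx
    rw [← hx, Pi.sub_apply]
    abel
  · rw [add_sub_add_right_eq_sub, hG]
    exact intervalIntegral.integral_interval_sub_left (I _ _) (I _ _)

/-! ### The spaces `L²` and `H¹` -/

theorem L2_locallyIntegrable (f : L2) : LocallyIntegrable f volume :=
  (Lp.memLp f).locallyIntegrable (by norm_num)

/-- The functional `f ↦ ∫ φ f` on `L²`. -/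
def testPairing (φ : ℝ → ℝ) (hφ : Continuous φ) (hc : HasCompactSupport φ) : L2 →L[ℝ] Plane :=
  (ContinuousLinearMap.lsmul ℝ ℝ).lpPairing volume 2 2
    ((hφ.memLp_of_hasCompactSupport (p := 2) (μ := volume) hc).toLp φ)

theorem testPairing_apply {φ : ℝ → ℝ} (hφ : Continuous φ) (hc : HasCompactSupport φ) (f : L2) :
    testPairing φ hφ hc f = ∫ x, φ x • f x := by
  rw [testPairing, ContinuousLinearMap.lpPairing_eq_integral]
  refine integral_congr_ae ?_
  filter_upwards [(hφ.memLp_of_hasCompactSupport (p := 2) (μ := volume) hc).coeFn_toLp] with x hx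
  rw [hx, ContinuousLinearMap.lsmul_apply]

theorem L2_ext_test {f g : L2} (h : ∀ φ : ℝ → ℝ, ContDiff ℝ ∞ φ → HasCompactSupport φ →
    ∫ x, φ x • f x = ∫ x, φ x • g x) : f = g :=
  Lp.ext (ae_eq_of_integral_contDiff_smul_eq (L2_locallyIntegrable f) (L2_locallyIntegrable g) h)

/-- Each test function imposes a closed condition, being an equality of continuous functionals. This
yields the completeness that Picard–Lindelöf requires. -/
theorem isClosed_H1 : IsClosed (H1 : Set (WithLp 2 (L2 × L2))) := by
  have e : (H1 : Set (WithLp 2 (L2 × L2))) = ⋂ (φ : ℝ → ℝ) (h1 : ContDiff ℝ ∞ φ)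
      (h2 : HasCompactSupport φ),
      {p | testPairing (deriv φ) (h1.continuous_deriv (by simp)) h2.deriv p.fst =
        - testPairing φ h1.continuous h2 p.snd} := by
    ext p
    simp only [mem_iInter, mem_ofPred_eq, testPairing_apply]
    rfl
  rw [e]
  refine isClosed_iInter fun φ => isClosed_iInter fun h1 => isClosed_iInter fun h2 =>
    isClosed_eq ?_ ?_
  · exact (ContinuousLinearMap.continuous _).comp (continuous_fst.comp
      (WithLp.prod_continuous_ofLp 2 _ _))
  · exact ((ContinuousLinearMap.continuous _).comp (continuous_snd.comp
      (WithLp.prod_continuous_ofLp 2 _ _))).neg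

instance : CompleteSpace H1 := isClosed_H1.completeSpace_coe

/-- The weak derivative of an element of `H¹`. -/
def weakDeriv (B : H1) : L2 := (B : WithLp 2 (L2 × L2)).snd

/-- The element of `H¹` given by an `L²` function with a weak derivative in `L²`. -/
def mkH1 (f g : L2) (h : IsWeakDeriv f g) : H1 := ⟨WithLp.toLp 2 (f, g), h⟩

theorem isWeakDeriv_weakDeriv (B : H1) : IsWeakDeriv (toL2 B) (weakDeriv B) := B.2

@[simp] theorem toL2_add (p q : H1) : toL2 (p + q) = toL2 p + toL2 q := rfl
@[simp] theorem weakDeriv_add (p q : H1) : weakDeriv (p + q) = weakDeriv p + weakDeriv q := rfl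
@[simp] theorem toL2_sub (p q : H1) : toL2 (p - q) = toL2 p - toL2 q := rfl
@[simp] theorem weakDeriv_sub (p q : H1) : weakDeriv (p - q) = weakDeriv p - weakDeriv q := rfl
@[simp] theorem toL2_smul (a : ℝ) (p : H1) : toL2 (a • p) = a • toL2 p := rfl
@[simp] theorem weakDeriv_smul (a : ℝ) (p : H1) : weakDeriv (a • p) = a • weakDeriv p := rfl

/-- Weak derivatives are unique, so identities in `H¹`, uniqueness of solutions included, may be
checked in `L²`. -/
theorem toL2_injective : Function.Injective toL2 := by
  intro p q h
  have h2 : weakDeriv p = weakDeriv q := by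
    refine L2_ext_test fun φ h1 h2 => ?_
    have e1 := isWeakDeriv_weakDeriv p φ h1 h2
    have e2 := isWeakDeriv_weakDeriv q φ h1 h2
    rw [h, e2, neg_inj] at e1
    exact e1.symm
  refine Subtype.ext ((WithLp.ofLp_injective 2) (Prod.ext h h2))

theorem norm_toL2_le (p : H1) : ‖toL2 p‖ ≤ ‖p‖ :=
  abs_le_of_sq_le_sq' (by rw [H1_norm_sq]; nlinarith [sq_nonneg ‖(p : WithLp 2 (L2 × L2)).snd‖])
    (norm_nonneg _) |>.2

theorem norm_weakDeriv_le (p : H1) : ‖weakDeriv p‖ ≤ ‖p‖ :=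
  abs_le_of_sq_le_sq' (by rw [H1_norm_sq, weakDeriv]; nlinarith [sq_nonneg ‖toL2 p‖])
    (norm_nonneg _) |>.2

theorem norm_H1_le (p : H1) : ‖p‖ ≤ ‖toL2 p‖ + ‖weakDeriv p‖ :=
  abs_le_of_sq_le_sq' (by
    rw [H1_norm_sq, ← weakDeriv]
    nlinarith [mul_nonneg (norm_nonneg (toL2 p)) (norm_nonneg (weakDeriv p))])
    (add_nonneg (norm_nonneg _) (norm_nonneg _)) |>.2

/-- The inclusion of `H¹` in `L²` as a continuous linear map. -/
def toL2L : H1 →L[ℝ] L2 :=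
  LinearMap.mkContinuous ⟨⟨toL2, toL2_add⟩, toL2_smul⟩ 1 fun p => by
    simpa using norm_toL2_le p

/-- The weak derivative as a continuous linear map. -/
def weakDerivL : H1 →L[ℝ] L2 :=
  LinearMap.mkContinuous ⟨⟨weakDeriv, weakDeriv_add⟩, weakDeriv_smul⟩ 1 fun p => by
    simpa using norm_weakDeriv_le p

theorem continuous_toL2 : Continuous toL2 := toL2L.continuous

theorem continuous_weakDeriv : Continuous weakDeriv := weakDerivL.continuous

theorem continuous_H1 {X : Type*} [TopologicalSpace X] {B : X → H1}
    (h1 : Continuous fun x => toL2 (B x)) (h2 : Continuous fun x => weakDeriv (B x)) :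
    Continuous B :=
  continuous_induced_rng.mpr ((WithLp.prod_continuous_toLp 2 L2 L2).comp (h1.prodMk h2))

theorem norm_mkH1_le {f g : L2} (h : IsWeakDeriv f g) : ‖mkH1 f g h‖ ≤ ‖f‖ + ‖g‖ :=
  norm_H1_le (mkH1 f g h)

theorem norm_mkH1_map_le (A : L2 →L[ℝ] L2) {M : ℝ} (hM : 0 ≤ M) (h : ∀ f, ‖A f‖ ≤ M * ‖f‖)
    (p : H1) (hp : IsWeakDeriv (A (toL2 p)) (A (weakDeriv p))) :
    ‖mkH1 (A (toL2 p)) (A (weakDeriv p)) hp‖ ≤ (M + M) * ‖p‖ := by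
  refine (norm_mkH1_le hp).trans ?_
  rw [add_mul]
  exact add_le_add ((h _).trans (mul_le_mul_of_nonneg_left (norm_toL2_le p) hM))
    ((h _).trans (mul_le_mul_of_nonneg_left (norm_weakDeriv_le p) hM))

/-- A linear operator on `L²` that preserves the relation of weak differentiability acts
on `H¹`. -/
def liftH1ₗ (A : L2 →L[ℝ] L2) (hA : ∀ f g : L2, IsWeakDeriv f g → IsWeakDeriv (A f) (A g)) :
    H1 →ₗ[ℝ] H1 where
  toFun p := mkH1 (A (toL2 p)) (A (weakDeriv p)) (hA _ _ (isWeakDeriv_weakDeriv p))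
  map_add' p q := toL2_injective (map_add A (toL2 p) (toL2 q))
  map_smul' a p := toL2_injective (map_smul A a (toL2 p))

/-- A bounded operator on `L²` that preserves the relation of weak differentiability is bounded
on `H¹`. -/
def liftH1 (A : L2 →L[ℝ] L2) (hA : ∀ f g : L2, IsWeakDeriv f g → IsWeakDeriv (A f) (A g)) :
    H1 →L[ℝ] H1 :=
  (liftH1ₗ A hA).mkContinuous (‖A‖ + ‖A‖) fun p =>
    norm_mkH1_map_le A (norm_nonneg A) A.le_opNorm p _

/-! ### Translations -/

theorem norm_translate (a : ℝ) (f : L2) : ‖translate a f‖ = ‖f‖ :=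
  (Lp.compMeasurePreservingₗᵢ ℝ (fun x : ℝ => x + a)
    (measurePreserving_add_right volume a)).norm_map f

theorem continuous_translate : Continuous fun q : ℝ × L2 => translate q.1 q.2 := by
  have hg : Continuous fun q : ℝ × L2 => (⟨fun x => x + q.1, by fun_prop⟩ : C(ℝ, ℝ)) :=
    ContinuousMap.continuous_of_continuous_uncurry _ (by
      simp only [Function.uncurry_def, ContinuousMap.coe_mk]
      fun_prop)
  exact Continuous.compMeasurePreservingLp (continuous_snd (X := ℝ) (Y := L2)) hg
    (fun q => measurePreserving_add_right volume q.1) (by norm_num)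

theorem integral_smul_translate {φ : ℝ → ℝ} (a : ℝ) (f : L2) :
    ∫ x, φ x • translate a f x = ∫ x, φ (x - a) • f x := by
  rw [← integral_add_right_eq_self (fun x => φ (x - a) • f x) a]
  refine integral_congr_ae ?_
  filter_upwards [translate_coeFn a f] with x hx
  simp only [hx, add_sub_cancel_right]

theorem IsWeakDeriv.translate {f g : L2} (h : IsWeakDeriv f g) (a : ℝ) :
    IsWeakDeriv (translate a f) (translate a g) := by
  intro φ h1 h2
  rw [integral_smul_translate, integral_smul_translate]
  have e := h (fun x => φ (x - a)) (h1.comp (contDiff_id.sub contDiff_const))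
    (h2.comp_homeomorph (Homeomorph.subRight a))
  simpa only [deriv_comp_sub_const] using e

theorem IsWeakDeriv.compLpL {f g : L2} (h : IsWeakDeriv f g) (A : Plane →L[ℝ] Plane) :
    IsWeakDeriv (A.compLpL 2 volume f) (A.compLpL 2 volume g) := by
  intro φ h1 h2
  have e : ∀ {ψ : ℝ → ℝ} (_ : Continuous ψ) (_ : HasCompactSupport ψ) (f : L2),
      ∫ x, ψ x • A.compLpL 2 volume f x = A (∫ x, ψ x • f x) := by
    intro ψ hψ hc f
    rw [← A.integral_comp_comm (integrable_smul_of_L2 hψ hc f)]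
    refine integral_congr_ae ?_
    filter_upwards [A.coeFn_compLpL (p := 2) (μ := volume) f] with x hx
    rw [hx, map_smul]
  rw [e (h1.continuous_deriv (by simp)) h2.deriv, e h1.continuous h2, h φ h1 h2, map_neg]

/-- The pairing is the convolution of `f` with the reflected test function; the derivative falls on
the smooth factor and weak differentiability moves it to `g`. -/
theorem hasDerivAt_integral_smul_translate {f g : L2} (h : IsWeakDeriv f g) {φ : ℝ → ℝ}
    (hφ : ContDiff ℝ ∞ φ) (hc : HasCompactSupport φ) (t : ℝ) :
    HasDerivAt (fun s => ∫ x, φ x • translate s f x) (∫ x, φ x • translate t g x) t := by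
  simp only [integral_smul_translate]
  have hψ : ContDiff ℝ ∞ fun x => φ (-x) := hφ.comp contDiff_neg
  have hψc : HasCompactSupport fun x => φ (-x) := hc.comp_homeomorph (Homeomorph.neg ℝ)
  have key := hψc.hasDerivAt_convolution_left (ContinuousLinearMap.lsmul ℝ ℝ)
    (hψ.of_le (by simp)) (L2_locallyIntegrable f) (μ := volume) t
  have e : ∀ s, (convolution (fun x => φ (-x)) f (ContinuousLinearMap.lsmul ℝ ℝ) volume) s =
      ∫ x, φ (x - s) • f x := by
    intro s
    rw [convolution_eq_swap]
    simp only [ContinuousLinearMap.lsmul_apply, neg_sub]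
  have e' : (convolution (deriv fun x => φ (-x)) f (ContinuousLinearMap.lsmul ℝ ℝ) volume) t =
      ∫ x, φ (x - t) • g x := by
    rw [convolution_eq_swap]
    have e1 := h (fun x => φ (x - t)) (hφ.comp (contDiff_id.sub contDiff_const))
      (hc.comp_homeomorph (Homeomorph.subRight t))
    rw [← neg_eq_iff_eq_neg] at e1
    rw [← e1, ← integral_neg]
    refine integral_congr_ae (Eventually.of_forall fun x => ?_)
    simp only [ContinuousLinearMap.lsmul_apply, deriv_comp_neg, deriv_comp_sub_const, neg_sub,
      neg_smul]
  rw [e'] at key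
  exact key.congr_of_eventuallyEq (Eventually.of_forall fun s => (e s).symm)

theorem translate_sub_eq_integral {f g : L2} (h : IsWeakDeriv f g) (a b : ℝ) :
    translate b f - translate a f = ∫ s in a..b, translate s g := by
  have hcont : Continuous fun s => translate s g :=
    Continuous.comp' continuous_translate (continuous_id.prodMk continuous_const)
  refine L2_ext_test fun φ h1 h2 => ?_
  rw [← testPairing_apply h1.continuous h2, ← testPairing_apply h1.continuous h2, map_sub,
    ← ContinuousLinearMap.intervalIntegral_comp_comm _ (hcont.intervalIntegrable _ _)]
  rw [eq_comm]
  refine intervalIntegral.integral_eq_sub_of_hasDerivAt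
    (f := fun s => testPairing φ h1.continuous h2 (translate s f)) (fun s _ => ?_)
    (((ContinuousLinearMap.continuous _).comp hcont).intervalIntegrable _ _)
  simpa only [testPairing_apply] using hasDerivAt_integral_smul_translate h h1 h2 s

/-- The weak identity `translate_sub_eq_integral` upgrades to a norm derivative because `s ↦
translate s g` is continuous in `L²`. -/
theorem hasDerivAt_translate {f g : L2} (h : IsWeakDeriv f g) (t : ℝ) :
    HasDerivAt (fun s => translate s f) (translate t g) t := by
  have hcont : Continuous fun s => translate s g :=
    Continuous.comp' continuous_translate (continuous_id.prodMk continuous_const)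
  have h1 := (intervalIntegral.integral_hasDerivAt_right (hcont.intervalIntegrable 0 t)
    (hcont.stronglyMeasurableAtFilter _ _) hcont.continuousAt).add_const (translate 0 f)
  refine h1.congr_of_eventuallyEq (Eventually.of_forall fun s => ?_)
  simp only [← translate_sub_eq_integral h]
  abel

/-- Differentiation of a curve that is transported by a translation. -/
theorem hasDerivWithinAt_translate_curve {w : ℝ → L2} {w' g : L2} {s : Set ℝ} {t : ℝ}
    (hw : HasDerivWithinAt w w' s t) (hg : IsWeakDeriv (w t) g) (a : ℝ) :
    HasDerivWithinAt (fun τ => translate (a * τ) (w τ)) (translate (a * t) (w' + a • g)) s t := by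
  -- Three contributions: the translation acting on the frozen `w t`, the remainder of `w`
  -- (translations are isometries), and the moving translation of `w'` (strong continuity).
  have h1 : HasDerivWithinAt (fun τ => translate (a * τ) (w t)) (a • translate (a * t) g) s t :=
    ((hasDerivAt_translate hg (a * t)).scomp t
      (by simpa using (hasDerivAt_id t).const_mul a)).hasDerivWithinAt
  rw [hasDerivWithinAt_iff_isLittleO] at h1 hw ⊢
  have h2 : (fun τ => translate (a * τ) (w τ - w t - (τ - t) • w')) =o[𝓝[s] t]
      fun τ => τ - t :=
    (hw.norm_left.congr_left fun τ => (norm_translate _ _).symm).of_norm_left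
  have hcont : Continuous fun τ => translate (a * τ) w' - translate (a * t) w' :=
    (Continuous.comp' continuous_translate
      (Continuous.prodMk (by fun_prop) continuous_const)).sub
      continuous_const
  have h3 : (fun τ => (τ - t) • (translate (a * τ) w' - translate (a * t) w')) =o[𝓝[s] t]
      fun τ => τ - t := by
    have hz : (fun τ => translate (a * τ) w' - translate (a * t) w') =o[𝓝[s] t]
        fun _ => (1 : ℝ) := by
      rw [isLittleO_one_iff]
      have := hcont.continuousWithinAt (s := s) (x := t)
      simpa [ContinuousWithinAt] using this
    simpa using (isBigO_refl (fun τ : ℝ => τ - t) (𝓝[s] t)).smul_isLittleO hz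
  refine ((h1.add h2).add h3).congr_left fun τ => ?_
  simp only [map_sub, map_smul, map_add, smul_sub, smul_add]
  abel

/-! ### The group -/

/-- The part of the group that moves along the characteristics of the eigenvalue `c + 1`. -/
def freePlus (c t : ℝ) : L2 →L[ℝ] L2 :=
  (projPlus.compLpL 2 volume).comp (translate ((c + 1) * t))

/-- The part of the group that moves along the characteristics of the eigenvalue `c - 1`. -/
def freeMinus (c t : ℝ) : L2 →L[ℝ] L2 :=
  (projMinus.compLpL 2 volume).comp (translate ((c - 1) * t))

theorem freeGroup_apply (c t : ℝ) (f : L2) :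
    freeGroup c t f = freePlus c t f + freeMinus c t f := rfl

theorem projPlus_apply (v : Plane) : projPlus v = !₂[(v 0 + v 1) / 2, (v 0 + v 1) / 2] := by
  ext i
  fin_cases i <;> simp [projPlus, Matrix.mulVec, dotProduct, Fin.sum_univ_two] <;> ring

theorem projMinus_apply (v : Plane) : projMinus v = !₂[(v 0 - v 1) / 2, (v 1 - v 0) / 2] := by
  ext i
  fin_cases i <;> simp [projMinus, Matrix.mulVec, dotProduct, Fin.sum_univ_two] <;> ring

/-- `projPlus` and `projMinus` are complementary projections, so the cross terms of the composition
vanish. -/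
theorem freeEvolution_freeEvolution (c s t : ℝ) (f : ℝ → Plane) (x : ℝ) :
    freeEvolution c s (freeEvolution c t f) x = freeEvolution c (s + t) f x := by
  have h1 : x + (c + 1) * (s + t) = x + (c + 1) * s + (c + 1) * t := by ring
  have h2 : x + (c - 1) * (s + t) = x + (c - 1) * s + (c - 1) * t := by ring
  simp only [freeEvolution, h1, h2, projPlus_apply, projMinus_apply]
  ext i
  fin_cases i <;> simp <;> ring

theorem freeGroup_freeGroup (c s t : ℝ) (f : L2) :
    freeGroup c s (freeGroup c t f) = freeGroup c (s + t) f := by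
  refine Lp.ext ?_
  have h (a : ℝ) := (measurePreserving_add_right volume a).quasiMeasurePreserving.ae_eq_comp
    (freeGroup_coeFn c t f)
  filter_upwards [freeGroup_coeFn c s (freeGroup c t f), freeGroup_coeFn c (s + t) f,
    h ((c + 1) * s), h ((c - 1) * s)] with x h1 h2 h3 h4
  rw [h1, h2, ← freeEvolution_freeEvolution]
  simp only [Function.comp_apply] at h3 h4
  rw [freeEvolution, h3, h4]
  rfl

theorem freeGroup_zero (c : ℝ) (f : L2) : freeGroup c 0 f = f := by
  refine Lp.ext ?_
  filter_upwards [freeGroup_coeFn c 0 f] with x h1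
  rw [h1, freeEvolution, projPlus_apply, projMinus_apply]
  ext i
  fin_cases i <;> simp <;> ring

theorem freeGroup_neg_freeGroup (c t : ℝ) (f : L2) : freeGroup c (-t) (freeGroup c t f) = f := by
  rw [freeGroup_freeGroup, neg_add_cancel, freeGroup_zero]

theorem freeGroup_freeGroup_neg (c t : ℝ) (f : L2) : freeGroup c t (freeGroup c (-t) f) = f := by
  rw [freeGroup_freeGroup, add_neg_cancel, freeGroup_zero]

theorem exists_norm_freeGroup_le : ∃ M : ℝ, 0 < M ∧ ∀ c t f, ‖freeGroup c t f‖ ≤ M * ‖f‖ := by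
  -- Translations are isometries, hence a bound uniform in `c` and `t`; the added `1` only makes it
  -- visibly positive.
  refine ⟨‖projPlus‖ + ‖projMinus‖ + 1, by positivity, fun c t f => ?_⟩
  rw [freeGroup_apply]
  refine (norm_add_le _ _).trans ?_
  have h1 : ‖freePlus c t f‖ ≤ ‖projPlus‖ * ‖f‖ :=
    (projPlus.norm_compLp_le _).trans_eq (congrArg _ (norm_translate _ f))
  have h2 : ‖freeMinus c t f‖ ≤ ‖projMinus‖ * ‖f‖ :=
    (projMinus.norm_compLp_le _).trans_eq (congrArg _ (norm_translate _ f))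
  nlinarith [norm_nonneg f]

theorem continuous_freePlus (c : ℝ) : Continuous fun q : ℝ × L2 => freePlus c q.1 q.2 :=
  Continuous.comp' (projPlus.compLpL 2 volume).continuous (Continuous.comp' continuous_translate
    ((continuous_fst.const_mul _).prodMk continuous_snd))

theorem continuous_freeMinus (c : ℝ) : Continuous fun q : ℝ × L2 => freeMinus c q.1 q.2 :=
  Continuous.comp' (projMinus.compLpL 2 volume).continuous (Continuous.comp' continuous_translate
    ((continuous_fst.const_mul _).prodMk continuous_snd))

theorem continuous_freeGroup (c : ℝ) : Continuous fun q : ℝ × L2 => freeGroup c q.1 q.2 :=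
  (continuous_freePlus c).add (continuous_freeMinus c)

theorem IsWeakDeriv.freeGroup {f g : L2} (h : IsWeakDeriv f g) (c t : ℝ) :
    IsWeakDeriv (freeGroup c t f) (freeGroup c t g) := by
  have h1 := (h.translate ((c + 1) * t)).compLpL projPlus
  have h2 := (h.translate ((c - 1) * t)).compLpL projMinus
  exact H1.add_mem (x := WithLp.toLp 2 (_, _)) (y := WithLp.toLp 2 (_, _)) h1 h2

theorem hasDerivWithinAt_freeGroup_curve {w : ℝ → L2} {w' g : L2} {s : Set ℝ} {t : ℝ}
    (hw : HasDerivWithinAt w w' s t) (hg : IsWeakDeriv (w t) g) (c : ℝ) :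
    HasDerivWithinAt (fun τ => freeGroup c τ (w τ))
      (freePlus c t (w' + (c + 1) • g) + freeMinus c t (w' + (c - 1) • g)) s t :=
  (((projPlus.compLpL 2 volume).hasFDerivAt.comp_hasDerivWithinAt t
    (hasDerivWithinAt_translate_curve hw hg (c + 1))).add
  ((projMinus.compLpL 2 volume).hasFDerivAt.comp_hasDerivWithinAt t
    (hasDerivWithinAt_translate_curve hw hg (c - 1))))

/-- The group on `H¹`. -/
def freeGroupH1 (c t : ℝ) : H1 →L[ℝ] H1 :=
  liftH1 (freeGroup c t) fun _ _ h => h.freeGroup c t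

theorem toL2_freeGroupH1 (c t : ℝ) (p : H1) :
    toL2 (freeGroupH1 c t p) = freeGroup c t (toL2 p) := rfl

theorem weakDeriv_freeGroupH1 (c t : ℝ) (p : H1) :
    weakDeriv (freeGroupH1 c t p) = freeGroup c t (weakDeriv p) := rfl

theorem continuous_freeGroup_comp {X : Type*} [TopologicalSpace X] (c : ℝ) {t : X → ℝ}
    {f : X → L2} (ht : Continuous t) (hf : Continuous f) :
    Continuous fun x => freeGroup c (t x) (f x) := by
  have h := Continuous.comp' (continuous_freeGroup c) (ht.prodMk hf)
  exact h

theorem continuous_freeGroupH1 (c : ℝ) :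
    Continuous fun q : ℝ × H1 => freeGroupH1 c q.1 q.2 := by
  refine continuous_H1 ?_ ?_
  · simp only [toL2_freeGroupH1]
    exact continuous_freeGroup_comp c continuous_fst (continuous_toL2.comp continuous_snd)
  · simp only [weakDeriv_freeGroupH1]
    exact continuous_freeGroup_comp c continuous_fst (continuous_weakDeriv.comp continuous_snd)

theorem norm_freeGroupH1_le {c t M : ℝ} (hM : 0 ≤ M) (h : ∀ f, ‖freeGroup c t f‖ ≤ M * ‖f‖)
    (p : H1) : ‖freeGroupH1 c t p‖ ≤ (M + M) * ‖p‖ := by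
  have h1 := norm_mkH1_map_le (freeGroup c t) hM h p ((isWeakDeriv_weakDeriv p).freeGroup c t)
  have h2 : freeGroupH1 c t p = mkH1 (freeGroup c t (toL2 p)) (freeGroup c t (weakDeriv p))
      ((isWeakDeriv_weakDeriv p).freeGroup c t) := rfl
  rwa [h2]

theorem exists_norm_freeGroupH1_le :
    ∃ M : ℝ, 0 < M ∧ ∀ (c t : ℝ) (p : H1), ‖freeGroupH1 c t p‖ ≤ M * ‖p‖ := by
  obtain ⟨M, hM, h⟩ := exists_norm_freeGroup_le
  exact ⟨M + M, by positivity, fun c t p => norm_freeGroupH1_le hM.le (h c t) p⟩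

/-! ### Pointwise estimates in `L²` and `H¹` -/

theorem L2_norm_le_of_ae_le {z p q r : L2} {a b c : ℝ} (ha : 0 ≤ a) (hb : 0 ≤ b) (hc : 0 ≤ c)
    (h : ∀ᵐ x, ‖z x‖ ≤ a * ‖p x‖ + b * ‖q x‖ + c * ‖r x‖) :
    ‖z‖ ≤ a * ‖p‖ + b * ‖q‖ + c * ‖r‖ := by
  set P : L2 → Lp ℝ 2 (volume : Measure ℝ) := fun p => (Lp.memLp p).norm.toLp with hP
  have hn : ∀ p, ‖P p‖ = ‖p‖ := fun p => by rw [hP, Lp.norm_toLp, eLpNorm_norm, Lp.norm_def]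
  have he : ∀ p : L2, ∀ᵐ x, P p x = ‖p x‖ := fun p => (Lp.memLp p).norm.coeFn_toLp
  have h1 : ‖z‖ ≤ ‖a • P p + b • P q + c • P r‖ := by
    refine Lp.norm_le_norm_of_ae_le ?_
    filter_upwards [h, he p, he q, he r, Lp.coeFn_add (a • P p + b • P q) (c • P r),
      Lp.coeFn_add (a • P p) (b • P q), Lp.coeFn_smul a (P p), Lp.coeFn_smul b (P q),
      Lp.coeFn_smul c (P r)] with x h1 h2 h3 h4 h5 h6 h7 h8 h9
    rw [h5, Pi.add_apply, h6, Pi.add_apply, h7, h8, h9]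
    simp only [Pi.smul_apply, smul_eq_mul, h2, h3, h4]
    exact h1.trans (le_abs_self _)
  refine h1.trans ((norm_add₃_le).trans (le_of_eq ?_))
  rw [norm_smul, norm_smul, norm_smul, hn, hn, hn, Real.norm_of_nonneg ha, Real.norm_of_nonneg hb,
    Real.norm_of_nonneg hc]

theorem integral_norm_unit_interval_le (f : L2) (x : ℝ) :
    ∫ t in x..x + 1, ‖f t‖ ≤ ‖f‖ := by
  rw [intervalIntegral.integral_of_le (by linarith)]
  have hm : AEStronglyMeasurable f (volume.restrict (Ioc x (x + 1))) :=
    (Lp.aestronglyMeasurable f).restrict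
  have : IsProbabilityMeasure ((volume : Measure ℝ).restrict (Ioc x (x + 1))) :=
    ⟨by simp⟩
  rw [integral_norm_eq_lintegral_enorm hm, ← eLpNorm_one_eq_lintegral_enorm, Lp.norm_def]
  refine ENNReal.toReal_mono (Lp.eLpNorm_ne_top f) ?_
  exact (eLpNorm_le_eLpNorm_of_exponent_le (by norm_num) hm).trans
    (eLpNorm_mono_measure _ Measure.restrict_le_self)

theorem IsWeakDeriv.congr {f f' g g' : ℝ → Plane} (h : IsWeakDeriv f g) (hf : f =ᵐ[volume] f')
    (hg : g =ᵐ[volume] g') : IsWeakDeriv f' g' := by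
  intro φ h1 h2
  have e1 : ∫ x, deriv φ x • f' x = ∫ x, deriv φ x • f x :=
    integral_congr_ae (hf.mono fun x hx => by simp only [hx])
  have e2 : ∫ x, φ x • g' x = ∫ x, φ x • g x :=
    integral_congr_ae (hg.mono fun x hx => by simp only [hx])
  rw [e1, e2]
  exact h φ h1 h2

/-- The Sobolev embedding `H¹ ⊆ L^∞`. -/
theorem ae_norm_le_of_H1 (p : H1) : ∀ᵐ x, ‖toL2 p x‖ ≤ 2 * ‖p‖ := by
  set f := toL2 p
  set g := weakDeriv p
  obtain ⟨u, hu, hu'⟩ := IsWeakDeriv.exists_primitive (L2_locallyIntegrable f)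
    (L2_locallyIntegrable g) (isWeakDeriv_weakDeriv p)
  have Ig : ∀ x y : ℝ, IntervalIntegrable g volume x y :=
    intervalIntegrable_of_locallyIntegrable (L2_locallyIntegrable g)
  have If : ∀ x y : ℝ, IntervalIntegrable f volume x y :=
    intervalIntegrable_of_locallyIntegrable (L2_locallyIntegrable f)
  have Iu : ∀ x y : ℝ, IntervalIntegrable u volume x y := fun x y =>
    (If x y).congr_ae (ae_restrict_of_ae hu)
  filter_upwards [hu] with x hx
  rw [hx]
  have h1 : ∀ y ∈ Icc x (x + 1), ‖u x‖ ≤ ‖u y‖ + ‖g‖ := by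
    intro y hy
    have e : u x = u y - ∫ t in x..y, g t := by rw [← hu']; abel
    rw [e]
    refine (norm_sub_le _ _).trans (add_le_add_right ?_ _)
    refine (intervalIntegral.norm_integral_le_integral_norm hy.1).trans
      (le_trans ?_ (integral_norm_unit_interval_le g x))
    exact intervalIntegral.integral_mono_interval le_rfl hy.1 hy.2
      (Eventually.of_forall fun _ => norm_nonneg _) (Ig _ _).norm
  -- Averaging over `y` in the unit interval bounds `‖u x‖` by `‖f‖ + ‖g‖`, whence the constant `2`.
  have h2 := intervalIntegral.integral_mono_on (a := x) (b := x + 1) (by linarith)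
    intervalIntegrable_const ((Iu _ _).norm.add intervalIntegrable_const) h1
  rw [intervalIntegral.integral_add (Iu _ _).norm intervalIntegrable_const] at h2
  simp only [intervalIntegral.integral_const, add_sub_cancel_left, one_smul] at h2
  have h3 : ∫ t in x..x + 1, ‖u t‖ = ∫ t in x..x + 1, ‖f t‖ :=
    intervalIntegral.integral_congr_ae (hu.mono fun t ht _ => by simp only [ht])
  rw [h3] at h2
  have h4 := integral_norm_unit_interval_le f x
  have h5 : ‖f‖ ≤ ‖p‖ := norm_toL2_le p
  have h6 : ‖g‖ ≤ ‖p‖ := norm_weakDeriv_le p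
  linarith

/-! ### Superposition operators -/

/-- A zeroth order term `f(x, W)` that vanishes at `W = 0`, with total derivative `D(x, W)`. The
`W`-derivative is bounded, the `x`-derivative has linear growth in `W`, and the total
derivative is Lipschitz in `W` on bounded sets, uniformly in `x`. -/
structure IsRegularTerm (f : ℝ → Plane → Plane) (D : ℝ → Plane → ℝ × Plane →L[ℝ] Plane)
    (K : ℝ) : Prop where
  nonneg : 0 ≤ K
  zero : ∀ x, f x 0 = 0
  hasFDerivAt : ∀ x W, HasFDerivAt (fun q : ℝ × Plane => f q.1 q.2) (D x W) (x, W)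
  continuous_deriv : Continuous fun q : ℝ × Plane => D q.1 q.2
  norm_fst_le : ∀ x W, ‖D x W (1, 0)‖ ≤ K * ‖W‖
  norm_snd_le : ∀ x W V, ‖D x W (0, V)‖ ≤ K * ‖V‖
  lipschitz : ∀ R : ℝ, ∃ K' : ℝ, 0 ≤ K' ∧ ∀ x W₁ W₂, ‖W₁‖ ≤ R → ‖W₂‖ ≤ R →
    ‖D x W₁ - D x W₂‖ ≤ K' * ‖W₁ - W₂‖

namespace IsRegularTerm

variable {f : ℝ → Plane → Plane} {D : ℝ → Plane → ℝ × Plane →L[ℝ] Plane} {K : ℝ}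

theorem continuous (h : IsRegularTerm f D K) : Continuous fun q : ℝ × Plane => f q.1 q.2 :=
  continuous_iff_continuousAt.mpr fun q => (h.hasFDerivAt q.1 q.2).continuousAt

theorem norm_sub_le (h : IsRegularTerm f D K) (x : ℝ) (W₁ W₂ : Plane) :
    ‖f x W₁ - f x W₂‖ ≤ K * ‖W₁ - W₂‖ := by
  refine convex_univ.norm_image_sub_le_of_norm_hasFDerivWithin_le (𝕜 := ℝ) (f := f x)
    (f' := fun W => (D x W).comp (ContinuousLinearMap.inr ℝ ℝ Plane)) (fun W _ => ?_)
    (fun W _ => ?_) (mem_univ W₂) (mem_univ W₁)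
  · exact ((h.hasFDerivAt x W).comp W (hasFDerivAt_prodMk_right x W)).hasFDerivWithinAt
  · refine ContinuousLinearMap.opNorm_le_bound _ h.nonneg fun V => ?_
    simpa using h.norm_snd_le x W V

theorem norm_le (h : IsRegularTerm f D K) (x : ℝ) (W : Plane) : ‖f x W‖ ≤ K * ‖W‖ := by
  simpa [h.zero] using h.norm_sub_le x W 0

theorem norm_sub_le_fst (h : IsRegularTerm f D K) (x y : ℝ) (W : Plane) :
    ‖f x W - f y W‖ ≤ K * ‖W‖ * ‖x - y‖ := by
  refine convex_univ.norm_image_sub_le_of_norm_hasDerivWithin_le (𝕜 := ℝ)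
    (f := fun x => f x W) (f' := fun x => D x W (1, 0)) (fun x _ => ?_)
    (fun x _ => h.norm_fst_le x W) (mem_univ y) (mem_univ x)
  have h1 : HasDerivAt (fun x : ℝ => (x, W)) ((1 : ℝ), (0 : Plane)) x :=
    (hasDerivAt_id x).prodMk (hasDerivAt_const x W)
  exact ((h.hasFDerivAt x W).comp_hasDerivAt x h1).hasDerivWithinAt

theorem norm_deriv_apply_le (h : IsRegularTerm f D K) (x : ℝ) (W V : Plane) :
    ‖D x W (1, V)‖ ≤ K * ‖W‖ + K * ‖V‖ := by
  have e : ((1 : ℝ), V) = (1, 0) + (0, V) := by simp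
  rw [e, map_add]
  exact (norm_add_le _ _).trans (add_le_add (h.norm_fst_le x W) (h.norm_snd_le x W V))

theorem memLp (h : IsRegularTerm f D K) (u : L2) :
    MemLp (fun x => f x (u x)) 2 (volume : Measure ℝ) := by
  refine (Lp.memLp u).of_le_mul (c := K) ?_ (Eventually.of_forall fun x => h.norm_le x (u x))
  exact h.continuous.comp_aestronglyMeasurable
    (aestronglyMeasurable_id.prodMk (Lp.aestronglyMeasurable u))

theorem memLp_deriv (h : IsRegularTerm f D K) (u g : L2) :
    MemLp (fun x => D x (u x) (1, g x)) 2 (volume : Measure ℝ) := by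
  have h1 : MemLp (fun x => K * ‖u x‖ + K * ‖g x‖) 2 (volume : Measure ℝ) :=
    ((Lp.memLp u).norm.const_mul K).add ((Lp.memLp g).norm.const_mul K)
  refine h1.of_le ?_ (Eventually.of_forall fun x => ?_)
  · have hc : Continuous fun q : (ℝ × Plane) × Plane => D q.1.1 q.1.2 (1, q.2) :=
      (h.continuous_deriv.comp continuous_fst).clm_apply
        (continuous_const.prodMk continuous_snd)
    exact hc.comp_aestronglyMeasurable
      ((aestronglyMeasurable_id.prodMk (Lp.aestronglyMeasurable u)).prodMk
        (Lp.aestronglyMeasurable g))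
  · exact (h.norm_deriv_apply_le x (u x) (g x)).trans (le_abs_self _)

/-- The superposition operator `u ↦ f(·, u(·))` on `L²`. -/
def superposition (h : IsRegularTerm f D K) (u : L2) : L2 := (h.memLp u).toLp

theorem superposition_coeFn (h : IsRegularTerm f D K) (u : L2) :
    h.superposition u =ᵐ[volume] fun x => f x (u x) := (h.memLp u).coeFn_toLp

/-- The derivative of `f(·, u(·))` given by the chain rule, where `g` is the derivative of `u`. -/
def superpositionDeriv (h : IsRegularTerm f D K) (u g : L2) : L2 := (h.memLp_deriv u g).toLp

theorem superpositionDeriv_coeFn (h : IsRegularTerm f D K) (u g : L2) :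
    h.superpositionDeriv u g =ᵐ[volume] fun x => D x (u x) (1, g x) :=
  (h.memLp_deriv u g).coeFn_toLp

theorem norm_superposition_sub_le (h : IsRegularTerm f D K) (u v : L2) :
    ‖h.superposition u - h.superposition v‖ ≤ K * ‖u - v‖ := by
  have := L2_norm_le_of_ae_le (z := h.superposition u - h.superposition v) (p := u - v) (q := 0)
    (r := 0) h.nonneg le_rfl le_rfl (by
      filter_upwards [Lp.coeFn_sub (h.superposition u) (h.superposition v), Lp.coeFn_sub u v,
        h.superposition_coeFn u, h.superposition_coeFn v] with x h1 h2 h3 h4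
      simp only [h1, h2, Pi.sub_apply, h3, h4, zero_mul, add_zero]
      exact h.norm_sub_le x _ _)
  simpa using this

theorem norm_superposition_le (h : IsRegularTerm f D K) (u : L2) :
    ‖h.superposition u‖ ≤ K * ‖u‖ := by
  have := L2_norm_le_of_ae_le (z := h.superposition u) (p := u) (q := 0)
    (r := 0) h.nonneg le_rfl le_rfl (by
      filter_upwards [h.superposition_coeFn u] with x h1
      simp only [h1, zero_mul, add_zero]
      exact h.norm_le x _)
  simpa using this

theorem norm_superpositionDeriv_le (h : IsRegularTerm f D K) (u g : L2) :
    ‖h.superpositionDeriv u g‖ ≤ K * ‖u‖ + K * ‖g‖ := by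
  have := L2_norm_le_of_ae_le (z := h.superpositionDeriv u g) (p := u) (q := g)
    (r := 0) h.nonneg h.nonneg le_rfl (by
      filter_upwards [h.superpositionDeriv_coeFn u g] with x h1
      simp only [h1, zero_mul, add_zero]
      exact h.norm_deriv_apply_le x _ _)
  simpa using this

/-- The chain rule in `H¹`. -/
theorem isWeakDeriv_superposition (h : IsRegularTerm f D K) {u g : L2} (hu : IsWeakDeriv u g) :
    IsWeakDeriv (h.superposition u) (h.superpositionDeriv u g) := by
  obtain ⟨v, hv, hv'⟩ := IsWeakDeriv.exists_primitive (L2_locallyIntegrable u)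
    (L2_locallyIntegrable g) hu
  have hv0 : v = fun x => (∫ t in (0 : ℝ)..x, g t) + v 0 := by
    funext x
    rw [← hv']
    abel
  have hvac : ∀ a b, AbsolutelyContinuousOnInterval v a b := by
    intro a b
    refine absolutelyContinuousOnInterval_of_dist_le (C := 1)
      (absolutelyContinuousOnInterval_integral (L2_locallyIntegrable g) 0 a b)
      fun x _ y _ => ?_
    rw [one_mul, hv0, dist_add_right]
  have hvd : ∀ᵐ x, HasDerivAt v (g x) x := by
    filter_upwards [LocallyIntegrable.ae_hasDerivAt_integral (L2_locallyIntegrable g)] with x hx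
    rw [hv0]
    exact (hx 0).add_const _
  have hk : (fun x => D x (v x) (1, g x)) =ᵐ[volume] h.superpositionDeriv u g := by
    filter_upwards [hv, h.superpositionDeriv_coeFn u g] with x h1 h2
    rw [h2, h1]
  refine IsWeakDeriv.congr (f := fun x => f x (v x)) (g := fun x => D x (v x) (1, g x))
    (isWeakDeriv_of_absolutelyContinuous (fun a b => ?_)
      ((L2_locallyIntegrable (h.superpositionDeriv u g)).congr hk.symm) ?_) ?_ hk
  · obtain ⟨M, hM⟩ := (hvac a b).exists_bound
    have hG : AbsolutelyContinuousOnInterval (fun x => (x, v x)) a b := by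
      have h1 : AbsolutelyContinuousOnInterval (fun x : ℝ => x) a b :=
        contDiff_id.contDiffOn.absolutelyContinuousOnInterval
      have h2 := Tendsto.add h1 (hvac a b)
      rw [add_zero] at h2
      refine squeeze_zero (fun E => Finset.sum_nonneg fun _ _ => dist_nonneg) (fun E => ?_) h2
      rw [← Finset.sum_add_distrib]
      refine Finset.sum_le_sum fun i _ => ?_
      rw [Prod.dist_eq]
      exact max_le (le_add_of_nonneg_right dist_nonneg) (le_add_of_nonneg_left dist_nonneg)
    -- On the range of `v`, bounded by `M`, `f` is Lipschitz with constant `K |M|` in `x` and `K` in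
    -- `W`; its increments are compared with those of the graph of `v`.
    refine absolutelyContinuousOnInterval_of_dist_le (C := K * |M| + K) hG fun x hx y hy => ?_
    have h1 : dist x y ≤ dist (x, v x) (y, v y) := by rw [Prod.dist_eq]; exact le_max_left _ _
    have h2 : dist (v x) (v y) ≤ dist (x, v x) (y, v y) := by
      rw [Prod.dist_eq]; exact le_max_right _ _
    rw [dist_eq_norm]
    have e : f x (v x) - f y (v y) = (f x (v x) - f y (v x)) + (f y (v x) - f y (v y)) := by abel
    rw [e, add_mul]
    refine (norm_add_le _ _).trans (add_le_add ?_ ?_)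
    · refine (h.norm_sub_le_fst x y (v x)).trans ?_
      have h3 : ‖v x‖ ≤ |M| := (hM x hx).trans (le_abs_self M)
      have := h.nonneg
      rw [← dist_eq_norm]
      gcongr
    · refine (h.norm_sub_le y (v x) (v y)).trans ?_
      rw [← dist_eq_norm]
      exact mul_le_mul_of_nonneg_left h2 h.nonneg
  · filter_upwards [hvd] with x hx
    have h1 : HasDerivAt (fun x : ℝ => (x, v x)) ((1 : ℝ), g x) x := (hasDerivAt_id x).prodMk hx
    exact (h.hasFDerivAt x (v x)).comp_hasDerivAt x h1
  · filter_upwards [hv, h.superposition_coeFn u] with x h1 h2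
    rw [h2, h1]

/-- The superposition operator on `H¹`. -/
def superpositionH1 (h : IsRegularTerm f D K) (p : H1) : H1 :=
  mkH1 (h.superposition (toL2 p)) (h.superpositionDeriv (toL2 p) (weakDeriv p))
    (h.isWeakDeriv_superposition (isWeakDeriv_weakDeriv p))

theorem toL2_superpositionH1 (h : IsRegularTerm f D K) (p : H1) :
    toL2 (h.superpositionH1 p) = h.superposition (toL2 p) := rfl

theorem weakDeriv_superpositionH1 (h : IsRegularTerm f D K) (p : H1) :
    weakDeriv (h.superpositionH1 p) = h.superpositionDeriv (toL2 p) (weakDeriv p) := rfl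

/-- The growth is linear since `D(x, u)(1, g)` is bounded by `K(‖u‖ + ‖g‖)` pointwise; this excludes
blow-up. -/
theorem norm_superpositionH1_le (h : IsRegularTerm f D K) (p : H1) :
    ‖h.superpositionH1 p‖ ≤ 3 * K * ‖p‖ := by
  refine (norm_H1_le _).trans ?_
  rw [toL2_superpositionH1, weakDeriv_superpositionH1]
  have h1 := h.norm_superposition_le (toL2 p)
  have h2 := h.norm_superpositionDeriv_le (toL2 p) (weakDeriv p)
  have h3 := mul_le_mul_of_nonneg_left (norm_toL2_le p) h.nonneg
  have h4 := mul_le_mul_of_nonneg_left (norm_weakDeriv_le p) h.nonneg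
  linarith

/-- The delicate term is `(D(x, u) - D(x, v))(1, g)` with `g` only in `L²`: the Sobolev embedding
puts `u - v` in `L^∞`. The constant depends on `R` through `‖g‖` and through the range of `u` and
`v`. -/
theorem exists_lipschitz_superpositionH1 (h : IsRegularTerm f D K) (R : ℝ) :
    ∃ K' : ℝ, 0 ≤ K' ∧ ∀ p q : H1, ‖p‖ ≤ R → ‖q‖ ≤ R →
      ‖h.superpositionH1 p - h.superpositionH1 q‖ ≤ K' * ‖p - q‖ := by
  -- The factor `2` is the Sobolev constant of `ae_norm_le_of_H1`.
  obtain ⟨K', hK', hlip⟩ := h.lipschitz (2 * R)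
  refine ⟨K + (K' + K' * 2 * |R| + K), by have := h.nonneg; positivity, fun p q hp hq => ?_⟩
  have hK := h.nonneg
  refine (norm_H1_le _).trans ?_
  rw [toL2_sub, weakDeriv_sub, toL2_superpositionH1, toL2_superpositionH1,
    weakDeriv_superpositionH1, weakDeriv_superpositionH1, add_mul]
  have e1 : ‖toL2 p - toL2 q‖ ≤ ‖p - q‖ := norm_toL2_le (p - q)
  have e2 : ‖weakDeriv p - weakDeriv q‖ ≤ ‖p - q‖ := norm_weakDeriv_le (p - q)
  refine add_le_add ((h.norm_superposition_sub_le _ _).trans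
    (mul_le_mul_of_nonneg_left e1 hK)) ?_
  have key := L2_norm_le_of_ae_le
    (z := h.superpositionDeriv (toL2 p) (weakDeriv p) -
      h.superpositionDeriv (toL2 q) (weakDeriv q))
    (p := toL2 p - toL2 q) (q := weakDeriv p) (r := weakDeriv p - weakDeriv q)
    (a := K') (b := K' * (2 * ‖p - q‖)) (c := K) hK' (by positivity) hK (by
      filter_upwards [Lp.coeFn_sub (h.superpositionDeriv (toL2 p) (weakDeriv p))
          (h.superpositionDeriv (toL2 q) (weakDeriv q)), Lp.coeFn_sub (toL2 p) (toL2 q),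
        Lp.coeFn_sub (weakDeriv p) (weakDeriv q),
        h.superpositionDeriv_coeFn (toL2 p) (weakDeriv p),
        h.superpositionDeriv_coeFn (toL2 q) (weakDeriv q), ae_norm_le_of_H1 p,
        ae_norm_le_of_H1 q, ae_norm_le_of_H1 (p - q)] with x h1 h2 h3 h4 h5 h6 h7 h8
      rw [toL2_sub] at h8
      simp only [h1, h2, h3, Pi.sub_apply, h4, h5] at h8 ⊢
      set u := toL2 p x
      set v := toL2 q x
      set g := weakDeriv p x
      set k := weakDeriv q x
      have e : D x u (1, g) - D x v (1, k) = (D x u - D x v) (1, g) + D x v (0, g - k) := by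
        have e' : ((0 : ℝ), g - k) = (1, g) - (1, k) := by simp
        rw [e', map_sub, sub_apply]
        abel
      rw [e]
      refine (norm_add_le _ _).trans (add_le_add ?_ (h.norm_snd_le x v _))
      refine ((D x u - D x v).le_opNorm _).trans ?_
      have n1 : ‖((1 : ℝ), g)‖ ≤ 1 + ‖g‖ := by
        rw [Prod.norm_def, norm_one]
        exact max_le (le_add_of_nonneg_right (norm_nonneg _)) (le_add_of_nonneg_left zero_le_one)
      have n2 := hlip x u v (h6.trans (by linarith)) (h7.trans (by linarith))
      calc ‖D x u - D x v‖ * ‖((1 : ℝ), g)‖ ≤ K' * ‖u - v‖ * (1 + ‖g‖) := by gcongr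
        _ = K' * ‖u - v‖ + K' * ‖u - v‖ * ‖g‖ := by ring
        _ ≤ K' * ‖u - v‖ + K' * (2 * ‖p - q‖) * ‖g‖ := by gcongr)
  refine key.trans ?_
  have e3 : ‖weakDeriv p‖ ≤ |R| := (norm_weakDeriv_le p).trans (hp.trans (le_abs_self R))
  calc K' * ‖toL2 p - toL2 q‖ + K' * (2 * ‖p - q‖) * ‖weakDeriv p‖ +
        K * ‖weakDeriv p - weakDeriv q‖
      ≤ K' * ‖p - q‖ + K' * (2 * ‖p - q‖) * |R| + K * ‖p - q‖ := by gcongr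
    _ = (K' + K' * 2 * |R| + K) * ‖p - q‖ := by ring

end IsRegularTerm

/-! ### Ordinary differential equations with linear growth -/

section ODE

variable {E : Type*} [NormedAddCommGroup E] [NormedSpace ℝ E]

/-- The radial retraction onto the ball of radius `R`. -/
def radialRetraction (R : ℝ) (w : E) : E := (R / max R ‖w‖) • w

theorem radialRetraction_of_norm_le {R : ℝ} (hR : 0 < R) {w : E} (hw : ‖w‖ ≤ R) :
    radialRetraction R w = w := by
  rw [radialRetraction, max_eq_left hw, div_self hR.ne', one_smul]

theorem norm_radialRetraction_le {R : ℝ} (hR : 0 < R) (w : E) :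
    ‖radialRetraction R w‖ ≤ R := by
  have h : 0 < max R ‖w‖ := lt_max_of_lt_left hR
  rw [radialRetraction, norm_smul, Real.norm_of_nonneg (by positivity), div_mul_eq_mul_div,
    div_le_iff₀ h]
  exact mul_le_mul_of_nonneg_left (le_max_right _ _) hR.le

theorem norm_radialRetraction_le_self {R : ℝ} (hR : 0 < R) (w : E) :
    ‖radialRetraction R w‖ ≤ ‖w‖ := by
  have h : 0 < max R ‖w‖ := lt_max_of_lt_left hR
  rw [radialRetraction, norm_smul, Real.norm_of_nonneg (by positivity)]
  exact mul_le_of_le_one_left (norm_nonneg w) ((div_le_one h).mpr (le_max_left _ _))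

theorem norm_radialRetraction_sub_le {R : ℝ} (hR : 0 < R) (v w : E) :
    ‖radialRetraction R v - radialRetraction R w‖ ≤ 2 * ‖v - w‖ := by
  set m := max R ‖v‖
  set n := max R ‖w‖
  have hm : 0 < m := lt_max_of_lt_left hR
  have hn : 0 < n := lt_max_of_lt_left hR
  have hRm : R ≤ m := le_max_left _ _
  have hwn : ‖w‖ ≤ n := le_max_right _ _
  have hmn : |n - m| ≤ ‖v - w‖ := by
    have h1 : |n - m| ≤ |‖w‖ - ‖v‖| := by
      simpa [n, m] using abs_max_sub_max_le_max R ‖w‖ R ‖v‖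
    rw [norm_sub_rev]
    exact h1.trans (abs_norm_sub_norm_le w v)
  have e : radialRetraction R v - radialRetraction R w =
      (R / m) • (v - w) + (R / m - R / n) • w := by
    simp only [radialRetraction, smul_sub, sub_smul]
    abel
  have e2 : R / m - R / n = R / m * ((n - m) / n) := by field_simp
  have h3 : R / m ≤ 1 := (div_le_one hm).mpr hRm
  rw [e, two_mul]
  refine (norm_add_le _ _).trans (add_le_add ?_ ?_)
  · rw [norm_smul, Real.norm_of_nonneg (by positivity)]
    exact mul_le_of_le_one_left (norm_nonneg _) h3
  · rw [e2, norm_smul, norm_mul, Real.norm_of_nonneg (by positivity : 0 ≤ R / m), norm_div,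
      Real.norm_of_nonneg hn.le, Real.norm_eq_abs, mul_assoc, div_mul_eq_mul_div |n - m|]
    refine (mul_le_of_le_one_left (by positivity) h3).trans ?_
    rw [div_le_iff₀ hn]
    exact mul_le_mul hmn hwn (norm_nonneg _) (norm_nonneg _)

/-- Composing `G` with the radial retraction makes it bounded and globally Lipschitz while keeping
its linear growth. Gronwall then confines the solution to the ball where the retraction is the
identity. -/
theorem exists_solution_Icc [CompleteSpace E] {G : ℝ → E → E} {A : ℝ} (hA : 0 ≤ A)
    (hcont : ∀ w, Continuous fun t => G t w) (hgrowth : ∀ t w, ‖G t w‖ ≤ A * ‖w‖)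
    (hlip : ∀ R : ℝ, ∃ L : ℝ, 0 ≤ L ∧ ∀ t v w, ‖v‖ ≤ R → ‖w‖ ≤ R →
      ‖G t v - G t w‖ ≤ L * ‖v - w‖) (w₀ : E) {T : ℝ} (hT : 0 ≤ T) :
    ∃ w : ℝ → E, w 0 = w₀ ∧ (∀ t ∈ Icc 0 T, HasDerivWithinAt w (G t (w t)) (Icc 0 T) t) ∧
      ∀ t ∈ Icc 0 T, ‖w t‖ ≤ ‖w₀‖ * Real.exp (A * t) := by
  set R : ℝ := ‖w₀‖ * Real.exp (A * T) + 1 with hRdef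
  have hR : 0 < R := by positivity
  obtain ⟨L, hL, hLip⟩ := hlip R
  -- The truncated field is bounded by `A R`, so radius `A R T` lets one Picard–Lindelöf step cover
  -- all of `[0, T]`.
  have hpl : IsPicardLindelof (fun t w => G t (radialRetraction R w))
      (⟨0, left_mem_Icc.mpr hT⟩ : Icc 0 T) w₀ (A * R * T).toNNReal 0 (A * R).toNNReal
      (L * 2).toNNReal := by
    refine ⟨fun t _ => ?_, fun w _ => (hcont _).continuousOn, fun t _ w _ => ?_, ?_⟩
    · refine LipschitzWith.lipschitzOnWith (LipschitzWith.of_dist_le_mul fun v w => ?_)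
      rw [dist_eq_norm, dist_eq_norm, Real.coe_toNNReal _ (by positivity), mul_assoc]
      exact (hLip t _ _ (norm_radialRetraction_le hR v) (norm_radialRetraction_le hR w)).trans
        (mul_le_mul_of_nonneg_left (norm_radialRetraction_sub_le hR v w) hL)
    · rw [Real.coe_toNNReal _ (by positivity)]
      exact (hgrowth t _).trans (mul_le_mul_of_nonneg_left (norm_radialRetraction_le hR w) hA)
    · rw [Real.coe_toNNReal _ (by positivity), Real.coe_toNNReal _ (by positivity)]
      simp [hT]
  obtain ⟨w, hw0, hw⟩ := hpl.exists_eq_forall_mem_Icc_hasDerivWithinAt₀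
  have hc : ContinuousOn w (Icc 0 T) := fun t ht => (hw t ht).continuousWithinAt
  have hb : ∀ t ∈ Icc 0 T, ‖w t‖ ≤ ‖w₀‖ * Real.exp (A * t) := by
    intro t ht
    have h1 := norm_le_gronwallBound_of_norm_deriv_right_le (δ := ‖w₀‖) (K := A) (ε := 0) hc
      (fun x hx => ((hw x (Ico_subset_Icc_self hx)).mono_of_mem_nhdsWithin
        (Icc_mem_nhdsGE_of_mem hx))) (by rw [← hw0])
      (fun x _ => by
        rw [add_zero]
        exact (hgrowth x _).trans
          (mul_le_mul_of_nonneg_left (norm_radialRetraction_le_self hR _) hA)) t ht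
    rwa [gronwallBound_ε0, sub_zero] at h1
  refine ⟨w, hw0, fun t ht => ?_, hb⟩
  have h1 := hw t ht
  rwa [radialRetraction_of_norm_le hR] at h1
  refine (hb t ht).trans ?_
  have : Real.exp (A * t) ≤ Real.exp (A * T) :=
    Real.exp_le_exp.mpr (mul_le_mul_of_nonneg_left ht.2 hA)
  rw [hRdef]
  nlinarith [norm_nonneg w₀]

theorem exists_global_solution [CompleteSpace E] {G : ℝ → E → E} {A : ℝ} (hA : 0 ≤ A)
    (hcont : ∀ w, Continuous fun t => G t w) (hgrowth : ∀ t w, ‖G t w‖ ≤ A * ‖w‖)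
    (hlip : ∀ R : ℝ, ∃ L : ℝ, 0 ≤ L ∧ ∀ t v w, ‖v‖ ≤ R → ‖w‖ ≤ R →
      ‖G t v - G t w‖ ≤ L * ‖v - w‖) (w₀ : E) :
    ∃ w : ℝ → E, w 0 = w₀ ∧ (∀ t, 0 ≤ t → HasDerivWithinAt w (G t (w t)) (Ici 0) t) ∧
      ∀ t, 0 ≤ t → ‖w t‖ ≤ ‖w₀‖ * Real.exp (A * t) := by
  choose w hw0 hw hb using fun n : ℕ => exists_solution_Icc hA hcont hgrowth hlip w₀
    (T := n) (Nat.cast_nonneg n)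
  have huniq : ∀ m n : ℕ, m ≤ n → EqOn (w m) (w n) (Icc 0 m) := by
    intro m n hmn
    have hsub : Icc (0 : ℝ) m ⊆ Icc 0 n := Icc_subset_Icc_right (Nat.cast_le.mpr hmn)
    -- The growth bound keeps both solutions in one ball up to time `m`, where a single Lipschitz
    -- constant serves.
    obtain ⟨L, hL, hLip⟩ := hlip (‖w₀‖ * Real.exp (A * m))
    have hbd : ∀ k : ℕ, m ≤ k → ∀ t ∈ Ico (0 : ℝ) m,
        w k t ∈ Metric.closedBall (0 : E) (‖w₀‖ * Real.exp (A * m)) := by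
      intro k hk t ht
      rw [mem_closedBall_zero_iff]
      refine (hb k t ⟨ht.1, ht.2.le.trans (Nat.cast_le.mpr hk)⟩).trans ?_
      have := ht.2.le
      gcongr
    refine ODE_solution_unique_of_mem_Icc_right (v := G) (K := L.toNNReal)
      (s := fun _ => Metric.closedBall 0 (‖w₀‖ * Real.exp (A * m))) (fun t _ => ?_)
      (fun t ht => (hw m t ht).continuousWithinAt)
      (fun t ht => (hw m t (Ico_subset_Icc_self ht)).mono_of_mem_nhdsWithin
        (Icc_mem_nhdsGE_of_mem ht)) (hbd m le_rfl)
      (fun t ht => ((hw n t (hsub ht)).continuousWithinAt).mono hsub)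
      (fun t ht => (hw n t (hsub (Ico_subset_Icc_self ht))).mono_of_mem_nhdsWithin
        (Icc_mem_nhdsGE_of_mem ⟨ht.1, ht.2.trans_le (Nat.cast_le.mpr hmn)⟩)) (hbd n hmn)
      (by rw [hw0, hw0])
    refine LipschitzOnWith.of_dist_le_mul fun x hx y hy => ?_
    rw [dist_eq_norm, dist_eq_norm, Real.coe_toNNReal _ hL]
    exact hLip t x y (mem_closedBall_zero_iff.mp hx) (mem_closedBall_zero_iff.mp hy)
  have heq : ∀ (n : ℕ) (t : ℝ), 0 ≤ t → t < n → w (⌊t⌋₊ + 1) t = w n t := by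
    intro n t h0 hn
    have h1 : ⌊t⌋₊ + 1 ≤ n := (Nat.floor_lt h0).mpr hn
    exact huniq _ _ h1 ⟨h0, by exact_mod_cast (Nat.lt_floor_add_one t).le⟩
  -- The index `⌊t⌋₊ + 1` exceeds `t` strictly, so the chosen solution is defined on a neighbourhood
  -- of `t` in `[0, ∞)`.
  refine ⟨fun t => w (⌊t⌋₊ + 1) t, by simp [hw0], fun t ht => ?_, fun t ht =>
    hb _ t ⟨ht, by exact_mod_cast (Nat.lt_floor_add_one t).le⟩⟩
  have hlt : t < ((⌊t⌋₊ + 1 : ℕ) : ℝ) := by exact_mod_cast Nat.lt_floor_add_one t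
  have hmem : Icc 0 ((⌊t⌋₊ + 1 : ℕ) : ℝ) ∈ 𝓝[Ici 0] t := by
    rw [← Ici_inter_Iic]
    exact inter_mem self_mem_nhdsWithin (mem_nhdsWithin_of_mem_nhds (Iic_mem_nhds hlt))
  have hmem' : Iio ((⌊t⌋₊ + 1 : ℕ) : ℝ) ∈ 𝓝[Ici 0] t :=
    mem_nhdsWithin_of_mem_nhds (Iio_mem_nhds hlt)
  refine ((hw (⌊t⌋₊ + 1) t ⟨ht, hlt.le⟩).mono_of_mem_nhdsWithin hmem).congr_of_eventuallyEq ?_ rfl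
  filter_upwards [self_mem_nhdsWithin, hmem'] with s hs hs'
  exact heq _ s hs hs'

end ODE

/-! ### Well-posedness -/

theorem contDiffOn_one_of_hasDerivWithinAt {E : Type*} [NormedAddCommGroup E] [NormedSpace ℝ E]
    {u u' : ℝ → E} (h : ∀ t, 0 ≤ t → HasDerivWithinAt u (u' t) (Ici 0) t)
    (hc : ContinuousOn u' (Ici 0)) : ContDiffOn ℝ 1 u (Ici 0) := by
  have hd : UniqueDiffOn ℝ (Ici (0 : ℝ)) := uniqueDiffOn_Ici 0
  rw [contDiffOn_one_iff_derivWithin hd]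
  refine ⟨fun t ht => (h t ht).differentiableWithinAt, hc.congr fun t ht => ?_⟩
  exact (h t ht).derivWithin (hd t ht)

theorem hasDerivWithinAt_toL2 {w : ℝ → H1} {w' : H1} {s : Set ℝ} {t : ℝ}
    (hw : HasDerivWithinAt w w' s t) :
    HasDerivWithinAt (fun t => toL2 (w t)) (toL2 w') s t := by
  have h := toL2L.hasFDerivAt.comp_hasDerivWithinAt t hw
  exact h

theorem contDiffOn_freeGroup_of_hasDerivWithinAt (c : ℝ) {v v' g : ℝ → L2}
    (hv : ∀ t, 0 ≤ t → HasDerivWithinAt v (v' t) (Ici 0) t)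
    (hg : ∀ t, 0 ≤ t → IsWeakDeriv (v t) (g t)) (hv' : ContinuousOn v' (Ici 0))
    (hgc : ContinuousOn g (Ici 0)) : ContDiffOn ℝ 1 (fun t => freeGroup c t (v t)) (Ici 0) := by
  have hd := fun t ht => hasDerivWithinAt_freeGroup_curve (hv t ht) (hg t ht) c
  refine contDiffOn_one_of_hasDerivWithinAt hd ?_
  have h1 : ∀ a : ℝ, ContinuousOn (fun t => (t, v' t + a • g t)) (Ici 0) := fun a =>
    continuousOn_id.prodMk (hv'.add (hgc.const_smul a))
  have h2 := (continuous_freePlus c).comp_continuousOn' (h1 (c + 1))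
  have h3 := (continuous_freeMinus c).comp_continuousOn' (h1 (c - 1))
  have h4 := h2.add h3
  exact h4

namespace IsRegularTerm

variable {f : ℝ → Plane → Plane} {D : ℝ → Plane → ℝ × Plane →L[ℝ] Plane} {K : ℝ}

theorem continuous_superposition (h : IsRegularTerm f D K) : Continuous h.superposition :=
  (LipschitzWith.of_dist_le_mul (K := K.toNNReal) fun u v => by
    rw [dist_eq_norm, dist_eq_norm, Real.coe_toNNReal _ h.nonneg]
    exact h.norm_superposition_sub_le u v).continuous

theorem continuous_superpositionH1 (h : IsRegularTerm f D K) :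
    Continuous h.superpositionH1 := by
  refine continuous_iff_continuousAt.mpr fun p => ?_
  obtain ⟨K', _, hK'⟩ := h.exists_lipschitz_superpositionH1 (‖p‖ + 1)
  have h1 : Tendsto (fun q : H1 => K' * ‖q - p‖) (𝓝 p) (𝓝 0) := by
    have : Continuous fun q : H1 => K' * ‖q - p‖ := by fun_prop
    simpa using this.tendsto p
  rw [ContinuousAt, tendsto_iff_norm_sub_tendsto_zero]
  refine squeeze_zero' (Eventually.of_forall fun _ => norm_nonneg _) ?_ h1
  filter_upwards [Metric.ball_mem_nhds p one_pos] with q hq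
  refine hK' q p ?_ (by linarith)
  have h2 := norm_sub_norm_le q p
  rw [mem_ball_iff_norm] at hq
  linarith

/-- The equation in the moving frame `w = T_c(-t) B`, on `L²`. -/
def field (h : IsRegularTerm f D K) (c t : ℝ) (w : L2) : L2 :=
  freeGroup c (-t) (h.superposition (freeGroup c t w))

/-- The equation in the moving frame `w = T_c(-t) B`, on `H¹`. -/
def fieldH1 (h : IsRegularTerm f D K) (c t : ℝ) (w : H1) : H1 :=
  freeGroupH1 c (-t) (h.superpositionH1 (freeGroupH1 c t w))

theorem continuous_fieldH1 (h : IsRegularTerm f D K) (c : ℝ) :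
    Continuous fun q : ℝ × H1 => h.fieldH1 c q.1 q.2 := by
  have h1 : Continuous fun q : ℝ × H1 => h.superpositionH1 (freeGroupH1 c q.1 q.2) :=
    Continuous.comp' h.continuous_superpositionH1 (continuous_freeGroupH1 c)
  have h2 := Continuous.comp' (continuous_freeGroupH1 c) (continuous_fst.neg.prodMk h1)
  exact h2

theorem exists_curve_H1 (h : IsRegularTerm f D K) (c : ℝ) :
    ∃ A : ℝ, 0 ≤ A ∧ ∀ B₀ : H1, ∃ w : ℝ → H1, w 0 = B₀ ∧
      (∀ t, 0 ≤ t → HasDerivWithinAt w (h.fieldH1 c t (w t)) (Ici 0) t) ∧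
      ∀ t, 0 ≤ t → ‖w t‖ ≤ ‖B₀‖ * Real.exp (A * t) := by
  obtain ⟨M, hM, hT⟩ := exists_norm_freeGroupH1_le
  have hK := h.nonneg
  refine ⟨M * (3 * K * M), by positivity, fun B₀ => ?_⟩
  refine exists_global_solution (by positivity) (fun w => ?_) (fun t w => ?_) (fun R => ?_) B₀
  · have h1 := Continuous.comp' (h.continuous_fieldH1 c)
      (continuous_id.prodMk (continuous_const (y := w)))
    exact h1
  · calc ‖h.fieldH1 c t w‖ ≤ M * ‖h.superpositionH1 (freeGroupH1 c t w)‖ := hT c _ _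
      _ ≤ M * (3 * K * ‖freeGroupH1 c t w‖) := by
        gcongr
        exact h.norm_superpositionH1_le _
      _ ≤ M * (3 * K * (M * ‖w‖)) := by
        gcongr
        exact hT c t w
      _ = M * (3 * K * M) * ‖w‖ := by ring
  · obtain ⟨L, hL, hLip⟩ := h.exists_lipschitz_superpositionH1 (M * R)
    refine ⟨M * (L * M), by positivity, fun t v w hv hw => ?_⟩
    have e : h.fieldH1 c t v - h.fieldH1 c t w = freeGroupH1 c (-t)
        (h.superpositionH1 (freeGroupH1 c t v) - h.superpositionH1 (freeGroupH1 c t w)) :=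
      (map_sub (freeGroupH1 c (-t)) _ _).symm
    have e2 : freeGroupH1 c t v - freeGroupH1 c t w = freeGroupH1 c t (v - w) :=
      (map_sub (freeGroupH1 c t) _ _).symm
    rw [e]
    calc _ ≤ M * ‖h.superpositionH1 (freeGroupH1 c t v) - h.superpositionH1 (freeGroupH1 c t w)‖ :=
          hT c _ _
      _ ≤ M * (L * ‖freeGroupH1 c t v - freeGroupH1 c t w‖) := by
        refine mul_le_mul_of_nonneg_left (hLip _ _ ?_ ?_) hM.le
        · exact (hT c t v).trans (mul_le_mul_of_nonneg_left hv hM.le)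
        · exact (hT c t w).trans (mul_le_mul_of_nonneg_left hw hM.le)
      _ ≤ M * (L * (M * ‖v - w‖)) := by
        rw [e2]
        gcongr
        exact hT c t _
      _ = M * (L * M) * ‖v - w‖ := by ring

/-- A mild solution, seen in the moving frame, solves an ordinary differential equation. -/
theorem hasDerivWithinAt_of_isMildSolution (h : IsRegularTerm f D K) {c : ℝ} {B₀ : L2}
    {B : ℝ → L2} (hc : ContinuousOn B (Ici 0)) (hB : IsMildSolution c f B₀ B) :
    B 0 = B₀ ∧ ContinuousOn (fun t => freeGroup c (-t) (B t)) (Ici 0) ∧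
    ∀ t, 0 ≤ t → HasDerivWithinAt (fun t => freeGroup c (-t) (B t))
      (h.field c t (freeGroup c (-t) (B t))) (Ici t) t := by
  obtain ⟨F, hF, hmild⟩ := hB
  have hF' : ∀ s, 0 ≤ s → F s = h.superposition (B s) := fun s hs =>
    Lp.ext ((hF s hs).trans (h.superposition_coeFn (B s)).symm)
  -- Freezing the curve at its initial value for negative times gives integrands continuous on the
  -- whole line.
  have hBc : Continuous fun s : ℝ => B (max s 0) :=
    hc.comp_continuous (continuous_id.max continuous_const) fun s =>
      mem_Ici.mpr (le_max_right s 0)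
  have hk : Continuous fun s : ℝ => freeGroup c (-s) (h.superposition (B (max s 0))) :=
    continuous_freeGroup_comp c continuous_neg (Continuous.comp' h.continuous_superposition hBc)
  -- Applying `T_c(-t)` turns the kernel `T_c(t - s)` into `T_c(-s)`, so the integrand no longer
  -- depends on `t`.
  have hform : ∀ t, 0 ≤ t → freeGroup c (-t) (B t) =
      B₀ + ∫ s in (0 : ℝ)..t, freeGroup c (-s) (h.superposition (B (max s 0))) := by
    intro t ht
    obtain ⟨hI, hBt⟩ := hmild t ht
    rw [hBt, map_add, freeGroup_neg_freeGroup,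
      ← ContinuousLinearMap.intervalIntegral_comp_comm _ hI]
    congr 1
    refine intervalIntegral.integral_congr fun s hs => ?_
    rw [uIcc_of_le ht] at hs
    rw [freeGroup_freeGroup, hF' s hs.1, max_eq_left hs.1]
    congr 2
    ring
  refine ⟨?_, ?_, fun t ht => ?_⟩
  · have := hform 0 le_rfl
    simpa [freeGroup_zero] using this
  · have h1 : ContinuousOn (fun t => freeGroup c (-t) (B (max t 0))) (Ici 0) :=
      (continuous_freeGroup_comp c continuous_neg hBc).continuousOn
    refine h1.congr fun t ht => ?_
    simp only [max_eq_left (mem_Ici.mp ht)]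
  · have h1 : HasDerivAt (fun t => B₀ + ∫ s in (0 : ℝ)..t,
        freeGroup c (-s) (h.superposition (B (max s 0))))
        (freeGroup c (-t) (h.superposition (B (max t 0)))) t :=
      (intervalIntegral.integral_hasDerivAt_right (hk.intervalIntegrable 0 t)
        (hk.stronglyMeasurableAtFilter _ _) hk.continuousAt).const_add B₀
    rw [field, freeGroup_freeGroup_neg]
    rw [max_eq_left ht] at h1
    exact h1.hasDerivWithinAt.congr (fun s hs => hform s (ht.trans hs)) (hform t ht)

theorem exists_lipschitz_field (h : IsRegularTerm f D K) (c : ℝ) :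
    ∃ L : ℝ, 0 ≤ L ∧ ∀ t v w, ‖h.field c t v - h.field c t w‖ ≤ L * ‖v - w‖ := by
  obtain ⟨M, hM, hT⟩ := exists_norm_freeGroup_le
  have hK := h.nonneg
  refine ⟨M * (K * M), by positivity, fun t v w => ?_⟩
  rw [field, field, ← map_sub]
  calc _ ≤ M * ‖h.superposition (freeGroup c t v) - h.superposition (freeGroup c t w)‖ :=
        hT _ _ _
    _ ≤ M * (K * ‖freeGroup c t v - freeGroup c t w‖) := by
      gcongr
      exact h.norm_superposition_sub_le _ _
    _ ≤ M * (K * (M * ‖v - w‖)) := by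
      rw [← map_sub]
      gcongr
      exact hT _ _ _
    _ = M * (K * M) * ‖v - w‖ := by ring

/-- In the moving frame both curves solve an ODE whose field is globally Lipschitz on `L²`, so no
`H¹` bound on the competitor is needed. -/
theorem isMildSolution_unique (h : IsRegularTerm f D K) {c : ℝ} {B₀ : L2} {B B' : ℝ → L2}
    (hc : ContinuousOn B (Ici 0)) (hB : IsMildSolution c f B₀ B)
    (hc' : ContinuousOn B' (Ici 0)) (hB' : IsMildSolution c f B₀ B') : EqOn B' B (Ici 0) := by
  obtain ⟨L, hL, hLip⟩ := h.exists_lipschitz_field c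
  obtain ⟨h0, h1, h2⟩ := h.hasDerivWithinAt_of_isMildSolution hc hB
  obtain ⟨h0', h1', h2'⟩ := h.hasDerivWithinAt_of_isMildSolution hc' hB'
  intro t ht
  have hu := ODE_solution_unique (v := h.field c) (K := L.toNNReal) (a := 0) (b := t)
    (fun t => LipschitzWith.of_dist_le_mul fun v w => by
      rw [dist_eq_norm, dist_eq_norm, Real.coe_toNNReal _ hL]
      exact hLip t v w)
    (h1'.mono Icc_subset_Ici_self) (fun s hs => h2' s hs.1)
    (h1.mono Icc_subset_Ici_self) (fun s hs => h2 s hs.1) (by simp only [h0, h0'])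
    (right_mem_Icc.mpr ht)
  have := congrArg (freeGroup c t) hu
  simpa only [freeGroup_freeGroup_neg] using this

/-- Curves in the moving frame give mild solutions. -/
theorem isMildSolution_of_hasDerivWithinAt (h : IsRegularTerm f D K) {c : ℝ} {w : ℝ → L2}
    (hw : ∀ t, 0 ≤ t → HasDerivWithinAt w (h.field c t (w t)) (Ici 0) t) :
    IsMildSolution c f (w 0) fun t => freeGroup c t (w t) := by
  have hwc : ContinuousOn w (Ici 0) := fun t ht => (hw t ht).continuousWithinAt
  have hwc' : Continuous fun s : ℝ => w (max s 0) :=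
    hwc.comp_continuous (continuous_id.max continuous_const) fun s =>
      mem_Ici.mpr (le_max_right s 0)
  have hS : Continuous fun s : ℝ => h.superposition (freeGroup c s (w (max s 0))) :=
    Continuous.comp' h.continuous_superposition
      (continuous_freeGroup_comp c continuous_id hwc')
  refine ⟨fun s => h.superposition (freeGroup c s (w (max s 0))), fun s hs => ?_,
    fun t ht => ⟨?_, ?_⟩⟩
  · simp only [max_eq_left hs]
    exact h.superposition_coeFn _
  · exact (continuous_freeGroup_comp c (continuous_const.sub continuous_id)
      hS).intervalIntegrable _ _
  · have hI : Continuous fun s : ℝ =>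
        freeGroup c (-s) (h.superposition (freeGroup c s (w (max s 0)))) :=
      continuous_freeGroup_comp c continuous_neg hS
    have hftc : ∫ s in (0 : ℝ)..t,
        freeGroup c (-s) (h.superposition (freeGroup c s (w (max s 0)))) = w t - w 0 := by
      refine intervalIntegral.integral_eq_sub_of_hasDeriv_right ?_ (fun s hs => ?_)
        (hI.intervalIntegrable _ _)
      · rw [uIcc_of_le ht]
        exact hwc.mono Icc_subset_Ici_self
      · rw [min_eq_left ht] at hs
        rw [max_eq_left hs.1.le]
        exact (hw s hs.1.le).mono fun r hr => hs.1.le.trans (mem_Ioi.mp hr).le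
    have e : ∀ s, freeGroup c (t - s) (h.superposition (freeGroup c s (w (max s 0)))) =
        freeGroup c t (freeGroup c (-s) (h.superposition (freeGroup c s (w (max s 0))))) := by
      intro s
      rw [freeGroup_freeGroup, sub_eq_add_neg]
    simp only [e]
    rw [ContinuousLinearMap.intervalIntegral_comp_comm _ (hI.intervalIntegrable _ _), hftc,
      ← map_add]
    congr 1
    abel

theorem contDiffOn_freeGroup_curve (h : IsRegularTerm f D K) {c : ℝ} {w : ℝ → H1}
    (hw : ∀ t, 0 ≤ t → HasDerivWithinAt w (h.fieldH1 c t (w t)) (Ici 0) t) :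
    ContDiffOn ℝ 1 (fun t => freeGroup c t (toL2 (w t))) (Ici 0) := by
  have hwc : ContinuousOn w (Ici 0) := fun t ht => (hw t ht).continuousWithinAt
  have h1 := (h.continuous_fieldH1 c).comp_continuousOn' (continuousOn_id.prodMk hwc)
  have h2 := continuous_toL2.comp_continuousOn' h1
  have h3 := continuous_weakDeriv.comp_continuousOn' hwc
  exact contDiffOn_freeGroup_of_hasDerivWithinAt c
    (fun t ht => hasDerivWithinAt_toL2 (hw t ht)) (fun t _ => isWeakDeriv_weakDeriv (w t)) h2 h3

theorem isGloballyWellPosed (h : IsRegularTerm f D K) (c : ℝ) : IsGloballyWellPosed c f := by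
  obtain ⟨A, hA, hex⟩ := h.exists_curve_H1 c
  obtain ⟨M, hM, hT⟩ := exists_norm_freeGroupH1_le
  -- `M` bounds the group and `A` is the growth rate, both fixed before `B₀`; the sum serves as
  -- prefactor and as rate.
  refine ⟨M + A, by positivity, fun B₀ => ?_⟩
  obtain ⟨w, hw0, hw, hwb⟩ := hex B₀
  have hwc : ContinuousOn w (Ici 0) := fun t ht => (hw t ht).continuousWithinAt
  have hBc : ContinuousOn (fun t => freeGroupH1 c t (w t)) (Ici 0) := by
    have h1 := (continuous_freeGroupH1 c).comp_continuousOn' (continuousOn_id.prodMk hwc)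
    exact h1
  have hmild : IsMildSolution c f (toL2 B₀) fun t => toL2 (freeGroupH1 c t (w t)) := by
    have h1 := h.isMildSolution_of_hasDerivWithinAt (c := c) (w := fun t => toL2 (w t))
      fun t ht => hasDerivWithinAt_toL2 (hw t ht)
    rw [hw0] at h1
    exact h1
  refine ⟨fun t => freeGroupH1 c t (w t), hBc, h.contDiffOn_freeGroup_curve hw, hmild,
    fun t ht => ?_, fun B' hB'c hB' t ht => toL2_injective ?_⟩
  · calc ‖freeGroupH1 c t (w t)‖ ≤ M * ‖w t‖ := hT c t _
      _ ≤ M * (‖B₀‖ * Real.exp (A * t)) := mul_le_mul_of_nonneg_left (hwb t ht) hM.le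
      _ = M * Real.exp (A * t) * ‖B₀‖ := by ring
      _ ≤ (M + A) * Real.exp ((M + A) * t) * ‖B₀‖ := by
        have h1 : A * t ≤ (M + A) * t := mul_le_mul_of_nonneg_right (by linarith) ht
        have h2 : M ≤ M + A := by linarith
        gcongr
  · exact h.isMildSolution_unique (continuous_toL2.comp_continuousOn' hBc) hmild
      (continuous_toL2.comp_continuousOn' hB'c) hB' ht

end IsRegularTerm

/-! ### Terms of the form `Φ(b(x), W)` -/

/-- Difference bounds on `Φ` control its partial derivatives. The `β`-derivative is only assumed of
size `1 + ‖W‖`, but it vanishes at `W = 0` because `Φ(β, 0) = 0`, which improves this to `‖W‖`. -/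
theorem isRegularTerm_of_profile {Φ : Plane × Plane → Plane} {b b' : ℝ → Plane} {M M' K₁ : ℝ}
    (hΦ : ContDiff ℝ 2 Φ) (h0 : ∀ β, Φ (β, 0) = 0) (hK₁ : 0 ≤ K₁)
    (hsnd : ∀ β W W', ‖β‖ ≤ M → ‖Φ (β, W') - Φ (β, W)‖ ≤ K₁ * ‖W' - W‖)
    (hfst : ∀ β β' W, ‖β‖ ≤ M → ‖Φ (β', W) - Φ (β, W)‖ ≤ K₁ * (1 + ‖W‖) * ‖β' - β‖)
    (hb : ∀ x, HasDerivAt b (b' x) x) (hbM : ∀ x, ‖b x‖ ≤ M) (hb'c : Continuous b')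
    (hb'M : ∀ x, ‖b' x‖ ≤ M') :
    ∃ D K, IsRegularTerm (fun x W => Φ (b x, W)) D K := by
  have hM' : 0 ≤ M' := (norm_nonneg _).trans (hb'M 0)
  have hd : ∀ q, HasFDerivAt Φ (fderiv ℝ Φ q) q := fun q =>
    ((hΦ.differentiable (by norm_num)) q).hasFDerivAt
  have hΦ' : ContDiff ℝ 1 (fderiv ℝ Φ) := hΦ.fderiv_right (by norm_num)
  have hbc : Continuous b := continuous_iff_continuousAt.mpr fun x => (hb x).continuousAt
  have bsnd : ∀ β W V, ‖β‖ ≤ M → ‖fderiv ℝ Φ (β, W) (0, V)‖ ≤ K₁ * ‖V‖ := by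
    intro β W V hβ
    have h1 : HasFDerivAt (fun W => Φ (β, W))
        ((fderiv ℝ Φ (β, W)).comp (ContinuousLinearMap.inr ℝ Plane Plane)) W :=
      (hd (β, W)).comp W (hasFDerivAt_prodMk_right β W)
    have h2 := h1.le_of_lip' hK₁ (Eventually.of_forall fun W' => hsnd β W W' hβ)
    simpa using ContinuousLinearMap.le_of_opNorm_le _ h2 V
  have bfst : ∀ β W V, ‖β‖ ≤ M → ‖fderiv ℝ Φ (β, W) (V, 0)‖ ≤ K₁ * (1 + ‖W‖) * ‖V‖ := by
    intro β W V hβ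
    have h1 : HasFDerivAt (fun β => Φ (β, W))
        ((fderiv ℝ Φ (β, W)).comp (ContinuousLinearMap.inl ℝ Plane Plane)) β :=
      (hd (β, W)).comp β (hasFDerivAt_prodMk_left β W)
    have h2 := h1.le_of_lip' (by positivity) (Eventually.of_forall fun β' => hfst β β' W hβ)
    simpa using ContinuousLinearMap.le_of_opNorm_le _ h2 V
  have zfst : ∀ β V, fderiv ℝ Φ (β, 0) (V, 0) = 0 := by
    intro β V
    have h1 : HasFDerivAt (fun β => Φ (β, 0))
        ((fderiv ℝ Φ (β, 0)).comp (ContinuousLinearMap.inl ℝ Plane Plane)) β :=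
      (hd (β, 0)).comp β (hasFDerivAt_prodMk_left β 0)
    simp only [h0] at h1
    have h2 := h1.unique (hasFDerivAt_const (0 : Plane) β)
    simpa using congrArg (fun A => A V) h2
  have hlip : ∀ R : ℝ, ∃ L : ℝ, 0 ≤ L ∧ ∀ β W₁ W₂, ‖β‖ ≤ M → ‖W₁‖ ≤ R → ‖W₂‖ ≤ R →
      ‖fderiv ℝ Φ (β, W₁) - fderiv ℝ Φ (β, W₂)‖ ≤ L * ‖W₁ - W₂‖ := by
    intro R
    obtain ⟨L, hL⟩ := (hΦ'.contDiffOn (s := Metric.closedBall (0 : Plane) M ×ˢ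
      Metric.closedBall (0 : Plane) R)).exists_lipschitzOnWith (by norm_num)
      ((convex_closedBall _ _).prod (convex_closedBall _ _))
      ((isCompact_closedBall _ _).prod (isCompact_closedBall _ _))
    refine ⟨L, L.2, fun β W₁ W₂ hβ h1 h2 => ?_⟩
    have := hL.dist_le_mul (β, W₁) ⟨by simpa using hβ, by simpa using h1⟩ (β, W₂)
      ⟨by simpa using hβ, by simpa using h2⟩
    rwa [dist_eq_norm, dist_eq_norm, Prod.mk_sub_mk, sub_self, Prod.norm_mk, norm_zero,
      max_eq_right (norm_nonneg _)] at this
  set J : ℝ → ℝ × Plane →L[ℝ] Plane × Plane := fun x =>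
    ((ContinuousLinearMap.toSpanSingleton ℝ (b' x)).comp
      (ContinuousLinearMap.fst ℝ ℝ Plane)).prod (ContinuousLinearMap.snd ℝ ℝ Plane) with hJ
  have hJa : ∀ x r V, J x (r, V) = (r • b' x, V) := fun x r V => rfl
  have hJn : ∀ x, ‖J x‖ ≤ M' + 1 := by
    intro x
    refine ContinuousLinearMap.opNorm_le_bound _ (by positivity) fun q => ?_
    obtain ⟨r, V⟩ := q
    rw [hJa, Prod.norm_mk, Prod.norm_mk, norm_smul]
    have h1 := le_max_left ‖r‖ ‖V‖
    have h2 := le_max_right ‖r‖ ‖V‖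
    have h3 := hb'M x
    have h4 : 0 ≤ max ‖r‖ ‖V‖ := (norm_nonneg r).trans h1
    refine max_le ?_ ?_
    · calc ‖r‖ * ‖b' x‖ ≤ max ‖r‖ ‖V‖ * M' := by gcongr
        _ ≤ (M' + 1) * max ‖r‖ ‖V‖ := by nlinarith
    · nlinarith
  have hJc : Continuous J := by
    have h1 : Continuous fun x => (ContinuousLinearMap.toSpanSingleton ℝ (b' x)).comp
        (ContinuousLinearMap.fst ℝ ℝ Plane) :=
      ((ContinuousLinearMap.toSpanSingletonCLE (𝕜 := ℝ) (E := Plane)).continuous.comp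
        hb'c).clm_comp continuous_const
    exact (ContinuousLinearMap.prodₗᵢ ℝ).continuous.comp (h1.prodMk continuous_const)
  -- For `‖W‖ ≤ 1` the `x`-derivative is compared with its zero value at `W = 0` through `L₁`; for
  -- `‖W‖ ≥ 1` one uses `1 + ‖W‖ ≤ 2 ‖W‖`.
  obtain ⟨L₁, hL₁, hLip₁⟩ := hlip 1
  refine ⟨fun x W => (fderiv ℝ Φ (b x, W)).comp (J x), K₁ + L₁ * M' + 2 * K₁ * M', ?_⟩
  refine ⟨by positivity, fun x => h0 _, fun x W => ?_, ?_, fun x W => ?_, fun x W V => ?_,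
    fun R => ?_⟩
  · have h1 : HasFDerivAt (fun q : ℝ × Plane => (b q.1, q.2)) (J x) (x, W) :=
      ((hb x).hasFDerivAt.comp (x, W) hasFDerivAt_fst).prodMk hasFDerivAt_snd
    exact (hd (b x, W)).comp (x, W) h1
  · have h1 : Continuous fun q : ℝ × Plane => fderiv ℝ Φ (b q.1, q.2) :=
      hΦ'.continuous.comp ((hbc.comp continuous_fst).prodMk continuous_snd)
    exact h1.clm_comp (hJc.comp continuous_fst)
  · simp only [ContinuousLinearMap.comp_apply, hJa, one_smul]
    rcases le_total ‖W‖ 1 with hW | hW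
    · have h1 := hLip₁ (b x) W 0 (hbM x) hW (by simp)
      rw [sub_zero] at h1
      have h2 := ContinuousLinearMap.le_of_opNorm_le _ h1 (b' x, 0)
      rw [sub_apply, zfst, sub_zero, Prod.norm_mk, norm_zero,
        max_eq_left (norm_nonneg _)] at h2
      have h3 : L₁ * ‖W‖ * ‖b' x‖ ≤ L₁ * ‖W‖ * M' := by gcongr; exact hb'M x
      have h4 : 0 ≤ (K₁ + 2 * K₁ * M') * ‖W‖ := by positivity
      nlinarith
    · have h1 := bfst (b x) W (b' x) (hbM x)
      have h2 : K₁ * (1 + ‖W‖) * ‖b' x‖ ≤ K₁ * (‖W‖ + ‖W‖) * M' := by gcongr; exact hb'M x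
      have h4 : 0 ≤ (K₁ + L₁ * M') * ‖W‖ := by positivity
      nlinarith
  · simp only [ContinuousLinearMap.comp_apply, hJa, zero_smul]
    refine (bsnd _ _ _ (hbM x)).trans ?_
    have h4 : 0 ≤ (L₁ * M' + 2 * K₁ * M') * ‖V‖ := by positivity
    nlinarith
  · obtain ⟨L, hL, hLip⟩ := hlip R
    refine ⟨L * (M' + 1), by positivity, fun x W₁ W₂ h1 h2 => ?_⟩
    rw [← ContinuousLinearMap.sub_comp]
    refine (ContinuousLinearMap.opNorm_comp_le _ _).trans ?_
    calc _ ≤ L * ‖W₁ - W₂‖ * (M' + 1) := by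
          gcongr
          · exact hLip _ _ _ (hbM x) h1 h2
          · exact hJn x
      _ = L * (M' + 1) * ‖W₁ - W₂‖ := by ring

/-! ### Saturable nonlinearities -/

/-- The function `y ↦ N(|y|²)` on the plane. -/
def radial (N : ℝ → ℝ) (y : Plane) : ℝ := N (‖y‖ ^ 2)

theorem plane_norm_sq (y : Plane) : ‖y‖ ^ 2 = y 0 ^ 2 + y 1 ^ 2 := by
  rw [EuclideanSpace.norm_sq_eq, Fin.sum_univ_two, Real.norm_eq_abs, Real.norm_eq_abs, sq_abs,
    sq_abs]

/-- The rotation `(u, v) ↦ (v, -u)`. -/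
def rot : Plane →L[ℝ] Plane :=
  Matrix.toEuclideanCLM (n := Fin 2) (𝕜 := ℝ) !![0, 1; -1, 0]

theorem rot_apply (v : Plane) : rot v = !₂[v 1, -v 0] := by
  ext i
  fin_cases i <;> simp [rot, Matrix.mulVec, dotProduct, Fin.sum_univ_two]

theorem norm_rot (v : Plane) : ‖rot v‖ = ‖v‖ := by
  rw [← sq_eq_sq₀ (norm_nonneg _) (norm_nonneg _), plane_norm_sq, plane_norm_sq, rot_apply]
  simp
  ring

theorem exists_bound_of_continuous {φ : Plane → ℝ} (hφ : Continuous φ) {R C : ℝ}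
    (h : ∀ y, R ≤ ‖y‖ → |φ y| ≤ C) : ∃ K : ℝ, 0 ≤ K ∧ ∀ y, |φ y| ≤ K := by
  obtain ⟨C', hC'⟩ := (isCompact_closedBall (0 : Plane) R).exists_bound_of_continuousOn
    hφ.continuousOn
  refine ⟨max 0 (max C C'), le_max_left _ _, fun y => ?_⟩
  rcases le_total R ‖y‖ with hy | hy
  · exact (h y hy).trans ((le_max_left _ _).trans (le_max_right _ _))
  · exact (hC' y (by simpa using hy)).trans ((le_max_right _ _).trans (le_max_right _ _))

namespace IsSaturable

variable {N : ℝ → ℝ}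

theorem contDiff_radial (hN : IsSaturable N) : ContDiff ℝ ∞ (radial N) := by
  rw [← contDiffOn_univ]
  exact hN.smooth.comp (contDiff_norm_sq ℝ).contDiffOn fun y _ => sq_nonneg ‖y‖

/-- The origin is excluded since `N` is controlled only on `[0, ∞)` and `deriv N 0` carries no
information. -/
theorem norm_fderiv_radial_le (hN : IsSaturable N) {y : Plane} (hy : y ≠ 0) :
    ‖fderiv ℝ (radial N) y‖ ≤ 2 * |deriv N (‖y‖ ^ 2)| * ‖y‖ := by
  have hpos : 0 < ‖y‖ ^ 2 := by positivity
  have h1 : HasDerivAt N (deriv N (‖y‖ ^ 2)) (‖y‖ ^ 2) :=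
    -- A nonzero value of `deriv` certifies differentiability.
    (differentiableAt_of_deriv_ne_zero (hN.deriv_neg _ hpos).ne).hasDerivAt
  have h2 := h1.comp_hasFDerivAt y (hasStrictFDerivAt_norm_sq y).hasFDerivAt
  have h3 : fderiv ℝ (radial N) y = _ := h2.fderiv
  rw [h3, norm_smul, Real.norm_eq_abs]
  have h4 : ‖(2 : ℕ) • innerSL ℝ y‖ ≤ 2 * ‖y‖ := by
    rw [two_nsmul, two_mul]
    refine (norm_add_le _ _).trans ?_
    rw [innerSL_apply_norm]
  calc _ ≤ |deriv N (‖y‖ ^ 2)| * (2 * ‖y‖) := by gcongr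
    _ = _ := by ring

theorem continuous_norm_fderiv_radial (hN : IsSaturable N) :
    Continuous fun y => ‖fderiv ℝ (radial N) y‖ :=
  (hN.contDiff_radial.continuous_fderiv (by simp)).norm

theorem exists_bound_radial (hN : IsSaturable N) :
    ∃ K : ℝ, 0 ≤ K ∧ ∀ y, |radial N y| ≤ K := by
  obtain ⟨a, _, ha, _⟩ := hN.saturates
  have h1 : ∀ᶠ s in atTop, |N s| ≤ |a| + 1 :=
    (ha.abs.eventually_lt_const (lt_add_one _)).mono fun _ h => h.le
  obtain ⟨S, hS⟩ := eventually_atTop.mp h1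
  refine exists_bound_of_continuous hN.contDiff_radial.continuous (R := max S 1) (C := |a| + 1)
    fun y hy => hS _ ?_
  have h2 : S ≤ ‖y‖ := (le_max_left _ _).trans hy
  have h3 : 1 ≤ ‖y‖ := (le_max_right _ _).trans hy
  nlinarith

/-- At radius `r` the gradient is at most `2 r |N'(r²)| = O(r^{-α})` by the decay hypothesis with `k
= 1`; compactness handles small `r`. -/
theorem exists_bound_fderiv_radial (hN : IsSaturable N) :
    ∃ K : ℝ, 0 ≤ K ∧ ∀ y, ‖fderiv ℝ (radial N) y‖ ≤ K := by
  obtain ⟨_, _, _, α, hα, _, hk⟩ := hN.saturates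
  obtain ⟨C, hC0, hC⟩ := (hk 1 le_rfl).exists_nonneg
  obtain ⟨S, hS⟩ := eventually_atTop.mp hC.bound
  obtain ⟨K, hK, h⟩ := exists_bound_of_continuous hN.continuous_norm_fderiv_radial
    (R := max S 1) (C := 2 * C) (fun y hy => by
      have h2 : S ≤ ‖y‖ := (le_max_left _ _).trans hy
      have h3 : 1 ≤ ‖y‖ := (le_max_right _ _).trans hy
      have hy0 : y ≠ 0 := norm_pos_iff.mp (by linarith)
      have h4 := hS _ h2
      rw [iteratedDeriv_one, Real.norm_eq_abs, Real.norm_of_nonneg (by positivity)] at h4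
      have h5 : ‖y‖ ^ (-α - ((1 : ℕ) : ℝ)) * ‖y‖ ≤ 1 := by
        rw [← Real.rpow_add_one (by positivity)]
        exact Real.rpow_le_one_of_one_le_of_nonpos h3 (by push_cast; linarith)
      rw [abs_norm]
      calc _ ≤ 2 * |deriv N (‖y‖ ^ 2)| * ‖y‖ := hN.norm_fderiv_radial_le hy0
        _ ≤ 2 * (C * ‖y‖ ^ (-α - ((1 : ℕ) : ℝ))) * ‖y‖ := by gcongr
        _ = 2 * C * (‖y‖ ^ (-α - ((1 : ℕ) : ℝ)) * ‖y‖) := by ring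
        _ ≤ 2 * C * 1 := by gcongr
        _ = 2 * C := mul_one _)
  exact ⟨K, hK, fun y => by simpa using h y⟩

/-- The quantity is at most `2 r² |N'(r²)|`, bounded exactly when `N'(s) = O(1/s)`; the `α`-decay
alone would give `O(r^{1-α})`. -/
theorem exists_bound_fderiv_radial_mul (hN : IsSaturable N)
    (hO : deriv N =O[atTop] fun s : ℝ => s⁻¹) :
    ∃ K : ℝ, 0 ≤ K ∧ ∀ y, ‖fderiv ℝ (radial N) y‖ * ‖y‖ ≤ K := by
  obtain ⟨C, hC0, hC⟩ := hO.exists_nonneg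
  obtain ⟨S, hS⟩ := eventually_atTop.mp hC.bound
  obtain ⟨K, hK, h⟩ := exists_bound_of_continuous
    (hN.continuous_norm_fderiv_radial.mul continuous_norm)
    (R := max S 1) (C := 2 * C) (fun y hy => by
      have h2 : S ≤ ‖y‖ := (le_max_left _ _).trans hy
      have h3 : 1 ≤ ‖y‖ := (le_max_right _ _).trans hy
      have hy0 : y ≠ 0 := norm_pos_iff.mp (by linarith)
      have h4 := hS (‖y‖ ^ 2) (by nlinarith)
      rw [Real.norm_eq_abs, Real.norm_of_nonneg (by positivity)] at h4
      rw [Pi.mul_apply, abs_mul, abs_norm, abs_norm]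
      calc _ ≤ 2 * |deriv N (‖y‖ ^ 2)| * ‖y‖ * ‖y‖ := by
            gcongr
            exact hN.norm_fderiv_radial_le hy0
        _ ≤ 2 * (C * (‖y‖ ^ 2)⁻¹) * ‖y‖ * ‖y‖ := by gcongr
        _ = 2 * C := by
            have : ‖y‖ ≠ 0 := by positivity
            field_simp)
  exact ⟨K, hK, fun y => (le_abs_self _).trans (h y)⟩

theorem exists_lipschitz_radial (hN : IsSaturable N) :
    ∃ K : ℝ, 0 ≤ K ∧ ∀ y z, |radial N y - radial N z| ≤ K * ‖y - z‖ := by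
  obtain ⟨K, hK, h⟩ := hN.exists_bound_fderiv_radial
  refine ⟨K, hK, fun y z => ?_⟩
  exact convex_univ.norm_image_sub_le_of_norm_fderiv_le (𝕜 := ℝ)
    (fun x _ => (hN.contDiff_radial.differentiable (by simp)) x) (fun x _ => h x)
    (mem_univ z) (mem_univ y)

theorem exists_lipschitz_radial_smul_rot (hN : IsSaturable N)
    (hO : deriv N =O[atTop] fun s : ℝ => s⁻¹) :
    ∃ K : ℝ, 0 ≤ K ∧ ∀ y z,
      ‖radial N y • rot y - radial N z • rot z‖ ≤ K * ‖y - z‖ := by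
  obtain ⟨K₁, hK₁, h₁⟩ := hN.exists_bound_radial
  obtain ⟨K₂, hK₂, h₂⟩ := hN.exists_bound_fderiv_radial_mul hO
  refine ⟨K₁ + K₂, by positivity, fun y z => ?_⟩
  refine convex_univ.norm_image_sub_le_of_norm_hasFDerivWithin_le (𝕜 := ℝ)
    (f := fun y => radial N y • rot y)
    (f' := fun y => radial N y • rot + (fderiv ℝ (radial N) y).smulRight (rot y))
    (fun x _ => ?_) (fun x _ => ?_) (mem_univ z) (mem_univ y)
  · exact (((hN.contDiff_radial.differentiable (by simp)) x).hasFDerivAt.smul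
      rot.hasFDerivAt).hasFDerivWithinAt
  · refine (norm_add_le _ _).trans (add_le_add ?_ ?_)
    · refine ContinuousLinearMap.opNorm_le_bound _ hK₁ fun v => ?_
      rw [smul_apply, norm_smul, norm_rot]
      exact mul_le_mul_of_nonneg_right (h₁ x) (norm_nonneg v)
    · rw [ContinuousLinearMap.norm_smulRight_apply, norm_rot]
      exact h₂ x

end IsSaturable

/-! ### The two perturbation equations -/

theorem pertNonlinearity_eq (N : ℝ → ℝ) (b : ℝ → Plane) (x : ℝ) (W : Plane) :
    pertNonlinearity N b x W = radial N (b x) • rot W +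
      (radial N (b x + W) - radial N (b x)) • rot (b x) := by
  simp only [pertNonlinearity, deltaN, radial, plane_norm_sq, rot_apply]
  ext i
  fin_cases i <;> simp <;> ring

theorem exactPertNonlinearity_eq (N : ℝ → ℝ) (b : ℝ → Plane) (x : ℝ) (W : Plane) :
    exactPertNonlinearity N b x W =
      radial N (b x + W) • rot (b x + W) - radial N (b x) • rot (b x) := by
  simp only [exactPertNonlinearity, deltaN, radial, plane_norm_sq, rot_apply]
  ext i
  fin_cases i <;> simp <;> ring

/-- The profile equation writes `b'` as a continuous function of `b`, so boundedness of `b` passes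
to `b'`. -/
theorem IsTravelingWaveProfile.exists_deriv {N : ℝ → ℝ} (hN : IsSaturable N) {c : ℝ}
    {b : ℝ → Plane} (hb : IsTravelingWaveProfile N c b) :
    ∃ (b' : ℝ → Plane) (M M' : ℝ), 0 ≤ M ∧ (∀ x, HasDerivAt b (b' x) x) ∧ (∀ x, ‖b x‖ ≤ M) ∧
      Continuous b' ∧ ∀ x, ‖b' x‖ ≤ M' := by
  obtain ⟨M, hM⟩ := hb.bounded
  set Ψ : Plane → Plane := fun y => !₂[radial N y / (1 - c ^ 2) * (y 0 + c * y 1),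
    radial N y / (1 - c ^ 2) * (-c * y 0 - y 1)] with hΨ
  have hG := hN.contDiff_radial.continuous
  have hc : Continuous Ψ := by
    refine (PiLp.continuous_toLp 2 _).comp (continuous_pi fun i => ?_)
    fin_cases i <;> (simp; fun_prop)
  have hd : ∀ x, HasDerivAt b (Ψ (b x)) x := by
    intro x
    have h1 : HasDerivAt (fun y i => b y i) (fun i => Ψ (b x) i) x := by
      rw [hasDerivAt_pi]
      intro i
      fin_cases i
      · simpa [hΨ, radial, plane_norm_sq] using hb.eq_u x
      · simpa [hΨ, radial, plane_norm_sq] using hb.eq_v x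
    exact (PiLp.continuousLinearEquiv 2 ℝ
      (fun _ : Fin 2 => ℝ)).symm.toContinuousLinearMap.hasFDerivAt.comp_hasDerivAt x h1
  have hbc : Continuous b := continuous_iff_continuousAt.mpr fun x => (hd x).continuousAt
  obtain ⟨M', hM'⟩ := (isCompact_closedBall (0 : Plane) M).exists_bound_of_continuousOn
    hc.continuousOn
  exact ⟨fun x => Ψ (b x), M, M', (norm_nonneg _).trans (hM 0), hd, hM, hc.comp hbc, fun x =>
    hM' _ (by simpa using hM x)⟩

theorem isGloballyWellPosed_pertNonlinearity {N : ℝ → ℝ} (hN : IsSaturable N) {c : ℝ}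
    {b : ℝ → Plane} (hb : IsTravelingWaveProfile N c b) :
    IsGloballyWellPosed c (pertNonlinearity N b) := by
  obtain ⟨b', M, M', hM, hd, hbM, hb'c, hb'M⟩ := hb.exists_deriv hN
  obtain ⟨K₁, hK₁, h₁⟩ := hN.exists_bound_radial
  obtain ⟨K₂, hK₂, h₂⟩ := hN.exists_lipschitz_radial
  have hG : ContDiff ℝ 2 (radial N) := contDiff_infty.mp hN.contDiff_radial 2
  have e : (fun x W => radial N (b x) • rot W +
      (radial N (b x + W) - radial N (b x)) • rot (b x)) = pertNonlinearity N b := by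
    funext x W
    rw [pertNonlinearity_eq]
  suffices h : ∃ D K, IsRegularTerm (pertNonlinearity N b) D K by
    obtain ⟨D, K, h⟩ := h
    exact h.isGloballyWellPosed c
  rw [← e]
  refine isRegularTerm_of_profile (b := b) (b' := b') (M := M) (M' := M')
    -- The first bracket serves the Lipschitz bound in `W`, the second the one in `β`.
    (K₁ := (K₁ + K₂ * M) + (K₂ + 2 * K₁ + 2 * K₂ * M))
    (Φ := fun q => radial N q.1 • rot q.2 + (radial N (q.1 + q.2) - radial N q.1) • rot q.1)
    ?_ ?_ (by positivity) ?_ ?_ hd hbM hb'c hb'M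
  · exact ((hG.comp contDiff_fst).smul (rot.contDiff.comp contDiff_snd)).add
      (((hG.comp (contDiff_fst.add contDiff_snd)).sub (hG.comp contDiff_fst)).smul
        (rot.contDiff.comp contDiff_fst))
  · intro β
    simp
  · intro β W W' hβ
    simp only
    have e : radial N β • rot W' + (radial N (β + W') - radial N β) • rot β -
        (radial N β • rot W + (radial N (β + W) - radial N β) • rot β) =
        radial N β • rot (W' - W) + (radial N (β + W') - radial N (β + W)) • rot β := by
      rw [map_sub]
      module
    have h3 := h₂ (β + W') (β + W)
    rw [add_sub_add_left_eq_sub] at h3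
    rw [e]
    refine (norm_add_le _ _).trans ?_
    rw [norm_smul, norm_smul, norm_rot, norm_rot, Real.norm_eq_abs, Real.norm_eq_abs]
    calc _ ≤ K₁ * ‖W' - W‖ + K₂ * ‖W' - W‖ * M := by
          gcongr
          exact h₁ β
      _ ≤ _ := by
          have : 0 ≤ (K₂ + 2 * K₁ + 2 * K₂ * M) * ‖W' - W‖ := by positivity
          nlinarith
  · intro β β' W hβ
    simp only
    -- Only the first group carries the factor `‖W‖`; the other two are bounded by `2 K₁` and `2 K₂
    -- M` times `‖β' - β‖`.
    have e : radial N β' • rot W + (radial N (β' + W) - radial N β') • rot β' -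
        (radial N β • rot W + (radial N (β + W) - radial N β) • rot β) =
        (radial N β' - radial N β) • rot W +
          (radial N (β' + W) - radial N β') • rot (β' - β) +
          ((radial N (β' + W) - radial N (β + W)) - (radial N β' - radial N β)) • rot β := by
      rw [map_sub]
      module
    have h3 := h₂ (β' + W) (β + W)
    rw [add_sub_add_right_eq_sub] at h3
    have h4 : |radial N (β' + W) - radial N β'| ≤ K₁ + K₁ :=
      (abs_sub _ _).trans (add_le_add (h₁ _) (h₁ _))
    have h5 : |(radial N (β' + W) - radial N (β + W)) - (radial N β' - radial N β)| ≤
        K₂ * ‖β' - β‖ + K₂ * ‖β' - β‖ := (abs_sub _ _).trans (add_le_add h3 (h₂ _ _))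
    rw [e]
    refine (norm_add₃_le).trans ?_
    rw [norm_smul, norm_smul, norm_smul, norm_rot, norm_rot, norm_rot, Real.norm_eq_abs,
      Real.norm_eq_abs, Real.norm_eq_abs]
    calc _ ≤ K₂ * ‖β' - β‖ * ‖W‖ + (K₁ + K₁) * ‖β' - β‖ +
          (K₂ * ‖β' - β‖ + K₂ * ‖β' - β‖) * M := by
          gcongr
          exact h₂ _ _
      _ = (K₂ * ‖W‖ + (2 * K₁ + 2 * K₂ * M)) * ‖β' - β‖ := by ring
      _ ≤ _ := by
          gcongr
          have h6 : 0 ≤ (K₁ + K₂ * M + K₂) * 1 := by positivity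
          have h7 : 0 ≤ (K₁ + K₂ * M + (2 * K₁ + 2 * K₂ * M)) * ‖W‖ := by positivity
          nlinarith

theorem isGloballyWellPosed_exactPertNonlinearity {N : ℝ → ℝ} (hN : IsSaturable N) {c : ℝ}
    {b : ℝ → Plane} (hb : IsTravelingWaveProfile N c b)
    (hO : deriv N =O[atTop] fun s : ℝ => s⁻¹) :
    IsGloballyWellPosed c (exactPertNonlinearity N b) := by
  obtain ⟨b', M, M', hM, hd, hbM, hb'c, hb'M⟩ := hb.exists_deriv hN
  obtain ⟨K₁, hK₁, h₁⟩ := hN.exists_lipschitz_radial_smul_rot hO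
  have hG : ContDiff ℝ 2 (radial N) := contDiff_infty.mp hN.contDiff_radial 2
  have hH : ContDiff ℝ 2 fun y => radial N y • rot y := hG.smul rot.contDiff
  have e : (fun x W => radial N (b x + W) • rot (b x + W) - radial N (b x) • rot (b x)) =
      exactPertNonlinearity N b := by
    funext x W
    rw [exactPertNonlinearity_eq]
  suffices h : ∃ D K, IsRegularTerm (exactPertNonlinearity N b) D K by
    obtain ⟨D, K, h⟩ := h
    exact h.isGloballyWellPosed c
  rw [← e]
  refine isRegularTerm_of_profile (b := b) (b' := b') (M := M) (M' := M')
    -- Moving `β` changes both values of the Lipschitz map, at `β + W` and at `β`.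
    (K₁ := 2 * K₁)
    (Φ := fun q => radial N (q.1 + q.2) • rot (q.1 + q.2) - radial N q.1 • rot q.1)
    ?_ ?_ (by positivity) ?_ ?_ hd hbM hb'c hb'M
  · exact (hH.comp (contDiff_fst.add contDiff_snd)).sub (hH.comp contDiff_fst)
  · intro β
    simp
  · intro β W W' _
    have h3 := h₁ (β + W') (β + W)
    rw [add_sub_add_left_eq_sub] at h3
    simp only [sub_sub_sub_cancel_right]
    have : 0 ≤ K₁ * ‖W' - W‖ := by positivity
    linarith
  · intro β β' W _
    have h3 := h₁ (β' + W) (β + W)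
    rw [add_sub_add_right_eq_sub] at h3
    simp only
    rw [sub_sub_sub_comm]
    refine (norm_sub_le _ _).trans ((add_le_add h3 (h₁ β' β)).trans ?_)
    have : 0 ≤ 2 * K₁ * ‖W‖ * ‖β' - β‖ := by positivity
    linarith

end

end DimerWave

theorem mainTheorem2 (N : ℝ → ℝ) (hN : DimerWave.IsSaturable N)
    (c : ℝ) (hc1 : c ≠ 1) (hc2 : c ≠ -1)
    (b : ℝ → DimerWave.Plane) (hb : DimerWave.IsTravelingWaveProfile N c b) :
    DimerWave.IsGloballyWellPosed c (DimerWave.pertNonlinearity N b) ∧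
      ((deriv N =O[atTop] fun s : ℝ => s⁻¹) →
        DimerWave.IsGloballyWellPosed c (DimerWave.exactPertNonlinearity N b)) :=
  ⟨DimerWave.isGloballyWellPosed_pertNonlinearity hN hb,
    DimerWave.isGloballyWellPosed_exactPertNonlinearity hN hb⟩
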